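/- Let $d\ge 1$, $\mu\in\mathbb R$, let $f:\mathbb R^d\to\mathbb R^d$ be smooth, and consider the lattice system $$U_j'(t)=\mu\,[U_{j+1}(t)-2U_j(t)+U_{j-1}(t)]+f(U_j(t)),\qquad j\in\mathbb Z.$$ Let $N\ge 1$ be an integer and $\underline k=1/N$. Let $(u^k,\omega(k))$, for $k$ in an open neighborhood of $\underline k$, be a smooth family (jointly in $k$ and the phase $\zeta$) of one-periodic profiles $u^k:\mathbb R\to\mathbb R^d$ and frequencies $\omega(k)\in\mathbb R$ such that $U_j(t)=u^k(kj+\omega(k)t)$ solves the system, i.e. $$\omega(k)\,\partial_\zeta u^k=\mu\,[u^k(\cdot+k)-2u^k+u^k(\cdot-k)]+f(u^k).$$ Write $u=u^{\underline k}$, $\omega=\omega(\underline k)$ and assume $\omega\neq 0$. For $\xi\in\mathbb R$ let $A_\xi(t)$ be the Bloch symbol of the linearization about $U_j(t)=u(\underline kj+\omega t)$, acting on $(\mathbb C^d)^{\mathbb Z/N\mathbb Z}$ by $$(A_\xi(t)V)_j=\mu\,[e^{i\xi}V_{j+1}-2V_j+e^{-i\xi}V_{j-1}]+Df(u(\underline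 kj+\omega t))V_j,$$ and let $S_\xi(t,s)$ be the evolution system that it generates. Assume that the wave is nondegenerate (assumption A): the sequence $(u'(j/N))_{j\in\mathbb Z/N\mathbb Z}$ is a basis of the generalized kernel of $S_0(1/\omega,0)-\mathrm{Id}$. Then there is $u^{\rm ad}\in H^1_{per}([0,1];\mathbb C^d)$ that spans the kernel of the operator $L^*w=\omega w'+\mu[w(\cdot-\underline k)-2w+w(\cdot+\underline k)]+Df(u)^{T}w$ (with domain $H^1_{per}$; the adjoint of the linearized profile operator) and satisfies $\langle u^{\rm ad},u'\rangle=1$ in $L^2_{per}([0,1])$. Moreover there are $\epsilon_0>0$, $\xi_0\in(0,\pi/N)$ and an analytic curve $\lambda:[-\xi_0,\xi_0]\to\mathbb C$ such that, for all $\xi\in[-\xi_0,\xi_0]$, $$\sigma(S_\xi(1/\omega,0))\cap B(1,\epsilon_0)=\{\lambda(\xi)\},$$ the eigenvalue $\lambda(\xi)$ of $S_\xi(1/\omega,0)$ is (algebraically) simple, and, if the parametrization of the family is normalized by $\langle u^{\rm ad},\partial_ku^k|_{k=\underline k}\rangle=0$, then as $\xi\to0$ $$\lambda(\xi)=\exp\Big(\tfrac1\omega\big(i\xi\,\partial_k\omega(\underline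 k)+(i\xi)^2\,d(\underline k)\big)\Big)+O(|\xi|^3),$$ where $$d(\underline k)=\Big\langle u^{\rm ad},\ \mu\,[\partial_ku^{\underline k}(\cdot+\underline k)-\partial_ku^{\underline k}(\cdot-\underline k)]+\tfrac12\mu\,[\partial_\zeta u^{\underline k}(\cdot+\underline k)+\partial_\zeta u^{\underline k}(\cdot-\underline k)]\Big\rangle .$$ -/

import Mathlib

open Set Filter Topology MeasureTheory
open scoped ComplexConjugate

noncomputable section

namespace LatticeRD

/-! ### Evolution systems of bounded linear non-autonomous equations -/

section Evolution

variable {X : Type*} [NormedAddCommGroup X] [NormedSpace ℂ X]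

/-- Terms of the Peano–Baker (Picard) series of `V' = A(t) V` started at time `s`. -/
def peanoBaker (A : ℝ → X →L[ℂ] X) (s : ℝ) : ℕ → ℝ → X →L[ℂ] X
  | 0 => fun _ => 1
  | n + 1 => fun t => ∫ r in s..t, A r * peanoBaker A s n r

/-- The evolution system `S(t,s)` generated by `A(·)`: the unique solution of
`∂ₜ S(t,s) = A(t) S(t,s)`, `S(s,s) = Id`, given by its Peano–Baker series
(see `evolution_self` and `hasDerivAt_evolution`). -/
def evolution (A : ℝ → X →L[ℂ] X) (t s : ℝ) : X →L[ℂ] X :=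
  ∑' n, peanoBaker A s n t

theorem continuous_peanoBaker {A : ℝ → X →L[ℂ] X} (hA : Continuous A) (s : ℝ) (n : ℕ) :
    Continuous (peanoBaker A s n) := by
  induction n with
  | zero => exact continuous_const
  | succ n ih =>
    exact intervalIntegral.continuous_primitive
      (fun a b => (hA.mul ih).intervalIntegrable a b) s

theorem evolution_self (A : ℝ → X →L[ℂ] X) (s : ℝ) : evolution A s s = 1 := by
  unfold evolution
  rw [tsum_eq_single 0]
  · rfl
  · intro n hn
    obtain ⟨m, rfl⟩ := Nat.exists_eq_succ_of_ne_zero hn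
    simp [peanoBaker]

theorem norm_peanoBaker_le {A : ℝ → X →L[ℂ] X} (s R M : ℝ)
    (hs : |s| ≤ R) (hM : ∀ r, |r| ≤ R → ‖A r‖ ≤ M) (n : ℕ) :
    ∀ t, |t| ≤ R →
      ‖peanoBaker A s n t‖ ≤ ‖(1 : X →L[ℂ] X)‖ * ((M * |t - s|) ^ n / n.factorial) := by
  have hM0 : 0 ≤ M := (norm_nonneg _).trans (hM s hs)
  induction n with
  | zero => intro t _; simp [peanoBaker]
  | succ n ih =>
    intro t ht
    have key : ‖∫ r in s..t, A r * peanoBaker A s n r‖ ≤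
        |∫ r in s..t, M * (‖(1 : X →L[ℂ] X)‖ * ((M * |r - s|) ^ n / n.factorial))| := by
      apply intervalIntegral.norm_integral_le_abs_of_norm_le
      · refine ae_restrict_of_forall_mem measurableSet_uIoc fun r hr => ?_
        have hr' : |r| ≤ R := by
          rw [abs_le] at *
          rcases le_total s t with h | h
          · rw [uIoc_of_le h] at hr; exact ⟨by linarith [hr.1], by linarith [hr.2]⟩
          · rw [uIoc_of_ge h] at hr; exact ⟨by linarith [hr.1], by linarith [hr.2]⟩
        refine (norm_mul_le _ _).trans ?_
        exact mul_le_mul (hM r hr') (ih r hr') (norm_nonneg _) hM0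
      · exact Continuous.intervalIntegrable (by fun_prop) _ _
    refine key.trans (le_of_eq ?_)
    have h1 : ∀ r, M * (‖(1 : X →L[ℂ] X)‖ * ((M * |r - s|) ^ n / n.factorial)) =
        (‖(1 : X →L[ℂ] X)‖ * M ^ (n + 1) / n.factorial) * |r - s| ^ n := by
      intro r; rw [mul_pow]; ring
    simp_rw [h1]
    rw [intervalIntegral.integral_const_mul, abs_mul, abs_of_nonneg (by positivity)]
    have h2 : |∫ r in s..t, |r - s| ^ n| = |t - s| ^ (n + 1) / (n + 1) := by
      rw [intervalIntegral.abs_integral_eq_abs_integral_uIoc,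
        abs_of_nonneg (integral_nonneg fun r => by positivity),
        integral_pow_abs_sub_uIoc]
    rw [h2, mul_pow, Nat.factorial_succ]
    push_cast
    field_simp

theorem hasDerivAt_peanoBaker_succ [CompleteSpace X] {A : ℝ → X →L[ℂ] X} (hA : Continuous A)
    (s : ℝ) (n : ℕ) (t : ℝ) :
    HasDerivAt (peanoBaker A s (n + 1)) (A t * peanoBaker A s n t) t := by
  have hc : Continuous fun r => A r * peanoBaker A s n r := hA.mul (continuous_peanoBaker hA s n)
  exact intervalIntegral.integral_hasDerivAt_right (hc.intervalIntegrable s t)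
    (hc.stronglyMeasurableAtFilter volume (𝓝 t)) hc.continuousAt

set_option maxHeartbeats 1000000 in
/-- The Peano–Baker series solves the differential equation. -/
theorem hasDerivAt_evolution [CompleteSpace X] {A : ℝ → X →L[ℂ] X} (hA : Continuous A)
    (t s : ℝ) :
    HasDerivAt (fun t => evolution A t s) (A t * evolution A t s) t := by
  set R : ℝ := |s| + |t| + 1 with hR
  obtain ⟨M, hM⟩ := (isCompact_Icc (a := -R) (b := R)).exists_bound_of_continuousOn hA.continuousOn
  have hM' : ∀ r, |r| ≤ R → ‖A r‖ ≤ M := fun r hr => hM r (abs_le.1 hr)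
  have hsR : |s| ≤ R := by rw [hR]; linarith [abs_nonneg t]
  have hM0 : 0 ≤ M := (norm_nonneg _).trans (hM' s hsR)
  have hb : ∀ n r, |r| ≤ R → ‖peanoBaker A s n r‖ ≤
      ‖(1 : X →L[ℂ] X)‖ * ((M * (2 * R)) ^ n / n.factorial) := by
    intro n r hr
    refine (norm_peanoBaker_le s R M hsR hM' n r hr).trans ?_
    have : |r - s| ≤ 2 * R := (abs_sub r s).trans (by linarith)
    gcongr
  have hsum : Summable fun n : ℕ => ‖(1 : X →L[ℂ] X)‖ * ((M * (2 * R)) ^ n / n.factorial) :=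
    (Real.summable_pow_div_factorial _).mul_left _
  have htR : |t| < R := by rw [hR]; linarith [abs_nonneg s]
  have hS : ∀ r, |r| ≤ R → Summable fun n => peanoBaker A s n r := fun r hr =>
    Summable.of_norm_bounded hsum fun n => hb n r hr
  have hd := hasDerivAt_tsum_of_isPreconnected
    (g := fun n r => peanoBaker A s (n + 1) r)
    (g' := fun n r => A r * peanoBaker A s n r)
    (u := fun n => M * (‖(1 : X →L[ℂ] X)‖ * ((M * (2 * R)) ^ n / n.factorial)))
    (t := Ioo (-R) R) (y₀ := t) (y := t) (hsum.mul_left M) isOpen_Ioo isPreconnected_Ioo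
    (fun n y _ => hasDerivAt_peanoBaker_succ hA s n y)
    (fun n y hy => by
      have hy' : |y| ≤ R := abs_le.2 ⟨hy.1.le, hy.2.le⟩
      exact (norm_mul_le _ _).trans
        (mul_le_mul (hM' y hy') (hb n y hy') (norm_nonneg _) hM0))
    (abs_lt.1 htR) ((summable_nat_add_iff 1).2 (hS t htR.le)) (abs_lt.1 htR)
  have hval : ∑' n, A t * peanoBaker A s n t = A t * evolution A t s :=
    (hS t htR.le).tsum_mul_left (A t)
  rw [hval] at hd
  have hd' := (hasDerivAt_const t (1 : X →L[ℂ] X)).add hd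
  rw [zero_add] at hd'
  refine hd'.congr_of_eventuallyEq ?_
  filter_upwards [Ioo_mem_nhds (abs_lt.1 htR).1 (abs_lt.1 htR).2] with r hr
  have hr' : |r| ≤ R := abs_le.2 ⟨hr.1.le, hr.2.le⟩
  exact (hS r hr').tsum_eq_zero_add

end Evolution

/-! ### Periodic traveling waves of
`U_j' = μ (U_{j+1} - 2 U_j + U_{j-1}) + f (U_j)`, `j ∈ ℤ` -/

section Waves

variable {d : ℕ}

/-- `u k`, `ω k`, for `k ∈ I`, is a smooth family of profiles and time frequencies, parametrized by
the wavenumber `k`, of periodic traveling waves `U_j(t) = u k (k j + ω(k) t)`. -/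
structure IsWaveFamily (μ : ℝ) (f : (Fin d → ℝ) → Fin d → ℝ) (I : Set ℝ)
    (u : ℝ → ℝ → Fin d → ℝ) (ω : ℝ → ℝ) : Prop where
  smooth_profile : ContDiffOn ℝ ((⊤ : ℕ∞) : WithTop ℕ∞) (fun p : ℝ × ℝ => u p.1 p.2) (I ×ˢ univ)
  smooth_freq : ContDiffOn ℝ ((⊤ : ℕ∞) : WithTop ℕ∞) ω I
  periodic : ∀ k ∈ I, Function.Periodic (u k) 1
  profile_eq : ∀ k ∈ I, ∀ ζ : ℝ,
    ω k • deriv (u k) ζ = μ • (u k (ζ + k) - (2 : ℝ) • u k ζ + u k (ζ - k)) + f (u k ζ)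

/-- Complexification of a real vector. -/
def toC (v : Fin d → ℝ) : Fin d → ℂ := fun a => (v a : ℂ)

/-- The Jacobian matrix of `f` at `x`, as a complex matrix. -/
def jac (f : (Fin d → ℝ) → Fin d → ℝ) (x : Fin d → ℝ) : Matrix (Fin d) (Fin d) ℂ :=
  Matrix.of fun a b => ((fderiv ℝ f x (Pi.single b 1) a : ℝ) : ℂ)

/-- The lattice system linearized about the wave `U_j(t) = u (k j + ω t)`:
`(A(t) V)_j = μ (V_{j+1} - 2 V_j + V_{j-1}) + Df(U_j(t)) V_j`. -/
def linearization (μ : ℝ) (f : (Fin d → ℝ) → Fin d → ℝ) (u : ℝ → Fin d → ℝ) (k ω t : ℝ) :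
    (ℤ → Fin d → ℂ) →ₗ[ℂ] (ℤ → Fin d → ℂ) where
  toFun V := fun j => (μ : ℂ) • (V (j + 1) - (2 : ℂ) • V j + V (j - 1)) +
    (jac f (u (k * j + ω * t))).mulVec (V j)
  map_add' V W := by
    funext j
    simp only [Pi.add_apply, Matrix.mulVec_add, smul_add, smul_sub]
    abel
  map_smul' c V := by
    funext j
    simp only [Pi.smul_apply, Matrix.mulVec_smul, RingHom.id_apply, smul_add, smul_sub,
      smul_comm c]

variable (N : ℕ)

/-- The sequence `j ↦ e^{i j ξ} g_j` on `ℤ`, for `g` on `ℤ/Nℤ`. -/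
def modulate (ξ : ℝ) : (ZMod N → Fin d → ℂ) →ₗ[ℂ] (ℤ → Fin d → ℂ) where
  toFun g := fun j => Complex.exp (Complex.I * j * ξ) • g (j : ZMod N)
  map_add' g h := by funext j; simp only [Pi.add_apply, smul_add]
  map_smul' c g := by funext j; simp only [Pi.smul_apply, RingHom.id_apply, smul_comm c]

/-- The discrete Bloch symbol `A_ξ = e^{-i · ξ} A e^{i · ξ}` at Floquet exponent `ξ` of an
`N`-periodic operator `A` on sequences; the value at a class mod `N` is read at its representative
in `{0, …, N-1}`. -/
def blochSymbol [NeZero N] (ξ : ℝ) (A : (ℤ → Fin d → ℂ) →ₗ[ℂ] (ℤ → Fin d → ℂ)) :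
    (ZMod N → Fin d → ℂ) →L[ℂ] (ZMod N → Fin d → ℂ) :=
  LinearMap.toContinuousLinearMap
    { toFun := fun g j => Complex.exp (-(Complex.I * (j.val : ℂ) * ξ)) •
        A (modulate N ξ g) (j.val : ℤ)
      map_add' := fun g h => by funext j; simp only [map_add, Pi.add_apply, smul_add]
      map_smul' := fun c g => by
        funext j
        simp only [map_smul, Pi.smul_apply, RingHom.id_apply, smul_comm c] }

/-- The one-period Floquet operator `S_ξ(1/ω, 0)` at Floquet exponent `ξ` of the lattice system
linearized about the wave of wavenumber `1/N` with profile `u` and frequency `ω`. -/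
def floquet [NeZero N] (μ : ℝ) (f : (Fin d → ℝ) → Fin d → ℝ) (u : ℝ → Fin d → ℝ) (ω : ℝ) (ξ : ℝ) :
    (ZMod N → Fin d → ℂ) →L[ℂ] (ZMod N → Fin d → ℂ) :=
  evolution (fun t => blochSymbol N ξ (linearization μ f u (1 / N) ω t)) (1 / ω) 0

/-- The generalized eigenspace of an operator `S` for the eigenvalue `z`. -/
def genEigenspace [NeZero N] (S : (ZMod N → Fin d → ℂ) →L[ℂ] (ZMod N → Fin d → ℂ)) (z : ℂ) :
    Submodule ℂ (ZMod N → Fin d → ℂ) :=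
  Module.End.maxGenEigenspace (S : (ZMod N → Fin d → ℂ) →ₗ[ℂ] (ZMod N → Fin d → ℂ)) z

/-- The `N`-periodic sequence `j ↦ u'(j/N)`, i.e. the time-translation mode at time `0`. -/
def translationMode (u : ℝ → Fin d → ℝ) : ZMod N → Fin d → ℂ :=
  fun j => toC (deriv u ((1 / N : ℝ) * j.val))

/-- Nondegeneracy of the wave of wavenumber `1/N`: the time-translation mode is a basis of the
generalized kernel of `S_0(1/ω, 0) - Id`. -/
def Nondegenerate [NeZero N] (μ : ℝ) (f : (Fin d → ℝ) → Fin d → ℝ) (u : ℝ → Fin d → ℝ) (ω : ℝ) :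
    Prop :=
  translationMode N u ≠ 0 ∧
    genEigenspace N (floquet N μ f u ω 0) 1 = Submodule.span ℂ {translationMode N u}

/-! ### The adjoint mode and the diffusion coefficient -/

/-- `v ∈ H¹_per([0,1]; ℂ^d)`, given by its continuous representative, with weak derivative `g`. -/
structure IsH1Per (v g : ℝ → Fin d → ℂ) : Prop where
  periodic : Function.Periodic v 1
  periodic_deriv : Function.Periodic g 1
  memLp : MemLp g 2 (volume.restrict (Ioc (0 : ℝ) 1))
  integral_eq : ∀ a b : ℝ, ∫ x in a..b, g x = v b - v a

/-- The scalar product of `L²_per([0,1]; ℂ^d)`, antilinear in the first variable. -/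
def inner01 (v w : ℝ → Fin d → ℂ) : ℂ :=
  ∫ ζ in (0 : ℝ)..1, ∑ a, conj (v ζ a) * w ζ a

/-- `w` belongs to the kernel of the adjoint, with domain `H¹_per`,
`L* w = ω w' + μ (w(· - k) - 2 w + w(· + k)) + Df(u)ᵀ w` of
`L v = -ω v' + μ (v(· + k) - 2 v + v(· - k)) + Df(u) v`. -/
def InKerAdjoint (μ : ℝ) (f : (Fin d → ℝ) → Fin d → ℝ) (u : ℝ → Fin d → ℝ) (k ω : ℝ)
    (w : ℝ → Fin d → ℂ) : Prop :=
  ∃ g : ℝ → Fin d → ℂ, IsH1Per w g ∧ ∀ᵐ ζ : ℝ,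
    (ω : ℂ) • g ζ + (μ : ℂ) • (w (ζ - k) - (2 : ℂ) • w ζ + w (ζ + k)) +
      (jac f (u ζ)).transpose.mulVec (w ζ) = 0

/-- `w` spans the kernel of `L*` and `⟨w, u'⟩ = 1`. -/
def IsAdjointMode (μ : ℝ) (f : (Fin d → ℝ) → Fin d → ℝ) (u : ℝ → Fin d → ℝ) (k ω : ℝ)
    (w : ℝ → Fin d → ℂ) : Prop :=
  InKerAdjoint μ f u k ω w ∧
    (∀ v, InKerAdjoint μ f u k ω v → ∃ c : ℂ, v = c • w) ∧
    inner01 w (fun ζ => toC (deriv u ζ)) = 1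

/-- `∂_ζ u^k`. -/
def dζ (u : ℝ → ℝ → Fin d → ℝ) (k ζ : ℝ) : Fin d → ℂ := toC (deriv (u k) ζ)

/-- `∂_k u^k`. -/
def dk (u : ℝ → ℝ → Fin d → ℝ) (k ζ : ℝ) : Fin d → ℂ := toC (deriv (fun κ => u κ ζ) k)

/-- The diffusion coefficient
`d(k) = ⟨w, μ [∂_k u(· + k) - ∂_k u(· - k)] + ½ μ [∂_ζ u(· + k) + ∂_ζ u(· - k)]⟩`,
with `w` the adjoint mode. -/
def diffusionCoeff (μ : ℝ) (u : ℝ → ℝ → Fin d → ℝ) (k : ℝ) (w : ℝ → Fin d → ℂ) : ℂ :=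
  inner01 w fun ζ =>
    (μ : ℂ) • (dk u k (ζ + k) - dk u k (ζ - k)) +
      ((1 / 2 : ℂ) * μ) • (dζ u k (ζ + k) + dζ u k (ζ - k))

end Waves

end LatticeRD

end

/-!
Write `x = iξ`. The Floquet operator `S(x) = S_ξ(1/ω, 0)` is holomorphic in `x`, and differentiating
the profile equation in `ζ` shows that it fixes `∂_ζ u` at `x = 0`. Nondegeneracy makes `1` a simple
root of its characteristic polynomial there, so the implicit function theorem continues it to a
simple eigenvalue `λ(x)`, holomorphic in `x`.

The expansion of `λ` comes from an approximate eigenvector `φ + x V₁ + x² V₂` along the wave.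
Differentiating the profile equation in `k` identifies `V₁` with `∂_k u` and the first coefficient
with `∂_k ω`. The equation for `V₂` is solvable only if its right-hand side is orthogonal to the
adjoint mode, and this Fredholm condition determines the second coefficient. The residual of the
approximate eigenpair is `O(x³)`; as the eigenvalue is simple, the adjugate of the characteristic
matrix turns it into an `O(x³)` error in `λ`.
-/

noncomputable section

namespace LatticeRD

open Asymptotics
open scoped Matrix InnerProductSpace

section LinearODE

variable {X : Type*} [NormedAddCommGroup X] [NormedSpace ℂ X] {A : ℝ → X →L[ℂ] X}

theorem linearODE_unique (hA : Continuous A) {V W : ℝ → X}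
    (hV : ∀ t, HasDerivAt V (A t (V t)) t) (hW : ∀ t, HasDerivAt W (A t (W t)) t)
    {t₀ : ℝ} (h : V t₀ = W t₀) : V = W := by
  funext t
  obtain ⟨a, ha⟩ := exists_lt (min t t₀)
  obtain ⟨b, hb⟩ := exists_gt (max t t₀)
  obtain ⟨M, hM⟩ := (isCompact_Icc (a := a) (b := b)).exists_bound_of_continuousOn hA.continuousOn
  have hLip : ∀ s ∈ Ioo a b, LipschitzOnWith M.toNNReal (A s) univ := fun s hs =>
    ((A s).lipschitz.weaken (NNReal.le_toNNReal_of_coe_le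
      (hM s (Ioo_subset_Icc_self hs)))).lipschitzOnWith
  exact ODE_solution_unique_of_mem_Ioo (v := fun t => A t) hLip
    ⟨ha.trans_le (min_le_right _ _), (le_max_right _ _).trans_lt hb⟩
    (fun s _ => ⟨hV s, mem_univ _⟩) (fun s _ => ⟨hW s, mem_univ _⟩) h
    ⟨ha.trans_le (min_le_left _ _), (le_max_left _ _).trans_lt hb⟩

variable [CompleteSpace X]

theorem hasDerivAt_evolution_apply (hA : Continuous A) (x : X) (t s : ℝ) :
    HasDerivAt (fun t => evolution A t s x) (A t (evolution A t s x)) t :=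
  ((ContinuousLinearMap.apply ℂ X x).restrictScalars ℝ).hasFDerivAt.comp_hasDerivAt t
    (hasDerivAt_evolution hA t s)

theorem continuous_evolution_apply (hA : Continuous A) (x : X) (s : ℝ) :
    Continuous fun t => evolution A t s x :=
  continuous_iff_continuousAt.2 fun t => (hasDerivAt_evolution_apply hA x t s).continuousAt

theorem eq_evolution_apply (hA : Continuous A) {V : ℝ → X}
    (hV : ∀ t, HasDerivAt V (A t (V t)) t) (t : ℝ) : V t = evolution A t 0 (V 0) :=
  congrFun (linearODE_unique hA hV (fun t => hasDerivAt_evolution_apply hA (V 0) t 0)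
    (t₀ := 0) (by simp [evolution_self])) t

theorem injective_evolution (hA : Continuous A) (t : ℝ) :
    Function.Injective (evolution A t 0) := fun x y hxy => by
  have := congrFun (linearODE_unique hA (fun t => hasDerivAt_evolution_apply hA x t 0)
    (fun t => hasDerivAt_evolution_apply hA y t 0) (t₀ := t) hxy) 0
  simpa [evolution_self] using this

theorem periodic_evolution_apply (hA : Continuous A) {T : ℝ} (hAT : Function.Periodic A T) {x : X}
    (hx : evolution A T 0 x = x) : Function.Periodic (fun t => evolution A t 0 x) T := fun t => by
  have h : ∀ t, HasDerivAt (fun t => evolution A (t + T) 0 x)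
      (A t (evolution A (t + T) 0 x)) t := fun t => by
    simpa only [hAT t] using (hasDerivAt_evolution_apply hA x (t + T) 0).comp_add_const t T
  simpa only [zero_add, hx] using eq_evolution_apply hA h t

theorem evolution_comp_mul (hA : Continuous A) (c t : ℝ) :
    evolution (fun r => (c : ℂ) • A (c * r)) t 0 = evolution A (c * t) 0 := by
  ext x
  have hV : ∀ t, HasDerivAt (fun t => evolution A (c * t) 0 x)
      (((c : ℂ) • A (c * t)) (evolution A (c * t) 0 x)) t := fun t =>
    ((hasDerivAt_evolution_apply hA x (c * t) 0).scomp t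
      ((hasDerivAt_id t).const_mul c)).congr_deriv (by simp)
  simpa [evolution_self] using
    (eq_evolution_apply (A := fun r => (c : ℂ) • A (c * r)) (by fun_prop) hV t).symm

theorem exists_solution_inhomogeneous (hA : Continuous A) {H : ℝ → X} (hH : Continuous H) :
    ∃ V : ℝ → X, V 0 = 0 ∧ ∀ t, HasDerivAt V (A t (V t) + H t) t := by
  -- the forcing becomes part of a homogeneous system on `X × ℂ`, with second component `1`
  let B : ℝ → (X × ℂ) →L[ℂ] (X × ℂ) := fun t => ContinuousLinearMap.inl ℂ X ℂ ∘L
    (A t ∘L ContinuousLinearMap.fst ℂ X ℂ +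
      ContinuousLinearMap.toSpanSingletonCLE (𝕜 := ℂ) (H t) ∘L ContinuousLinearMap.snd ℂ X ℂ)
  have hB : Continuous B := continuous_const.clm_comp ((hA.clm_comp continuous_const).add
    ((ContinuousLinearMap.toSpanSingletonCLE.continuous.comp hH).clm_comp continuous_const))
  let Z : ℝ → X × ℂ := fun t => evolution B t 0 (0, 1)
  have hZ : ∀ t, HasDerivAt Z (B t (Z t)) t := fun t => hasDerivAt_evolution_apply hB _ t 0
  have hZ0 : Z 0 = (0, 1) := by simp [Z, evolution_self]
  have hsnd : ∀ t, (Z t).2 = 1 := fun t => by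
    have hd : ∀ t, HasDerivAt (fun t => (Z t).2) 0 t := fun t =>
      ((ContinuousLinearMap.snd ℝ X ℂ).hasFDerivAt.comp_hasDerivAt t (hZ t)).congr_deriv
        (by simp [B])
    simpa [hZ0] using is_const_of_deriv_eq_zero (fun t => (hd t).differentiableAt)
      (fun t => (hd t).deriv) t 0
  refine ⟨fun t => (Z t).1, by simp [hZ0], fun t => ?_⟩
  refine ((ContinuousLinearMap.fst ℝ X ℂ).hasFDerivAt.comp_hasDerivAt t (hZ t)).congr_deriv ?_
  simp [B, hsnd]

theorem norm_evolution_sub_le (hA : Continuous A) {P R : ℝ → X} {K ε : ℝ}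
    (hK : ∀ t ∈ Icc (0 : ℝ) 1, ‖A t‖ ≤ K) (hP : ∀ t, HasDerivAt P (A t (P t) + R t) t)
    (hR : ∀ t ∈ Icc (0 : ℝ) 1, ‖R t‖ ≤ ε) :
    ‖evolution A 1 0 (P 0) - P 1‖ ≤ gronwallBound 0 K 1 1 * ε := by
  have hD : ∀ t, HasDerivAt (fun t => evolution A t 0 (P 0) - P t)
      (A t (evolution A t 0 (P 0) - P t) - R t) t := fun t =>
    ((hasDerivAt_evolution_apply hA (P 0) t 0).sub (hP t)).congr_deriv
      (by rw [map_sub, sub_add_eq_sub_sub])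
  have hbound : ∀ t ∈ Ico (0 : ℝ) 1, ‖A t (evolution A t 0 (P 0) - P t) - R t‖ ≤
      K * ‖evolution A t 0 (P 0) - P t‖ + ε := fun t ht =>
    (norm_sub_le _ _).trans (add_le_add ((A t).le_of_opNorm_le (hK t (Ico_subset_Icc_self ht)) _)
      (hR t (Ico_subset_Icc_self ht)))
  have h := norm_le_gronwallBound_of_norm_deriv_right_le (δ := 0)
    (fun t _ => (hD t).continuousAt.continuousWithinAt)
    (fun t _ => (hD t).hasDerivWithinAt) (by simp [evolution_self]) hbound
    1 (right_mem_Icc.2 zero_le_one)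
  refine h.trans (le_of_eq ?_)
  unfold gronwallBound
  split_ifs
  · simp
  · simp; ring

end LinearODE

section Parameters

theorem isBigO_one_of_continuous {Y Z E : Type*} [TopologicalSpace Y] [TopologicalSpace Z]
    [NormedAddCommGroup E] {F : Y × Z → E} (hF : Continuous F) (y : Y) {K : Set Z}
    (hK : IsCompact K) : F =O[𝓝 y ×ˢ 𝓟 K] fun _ => (1 : ℝ) := by
  obtain ⟨M, hM⟩ := ((isCompact_singleton (x := y)).prod hK).exists_bound_of_continuousOn
    hF.continuousOn
  have hmem : {p | ‖F p‖ < M + 1} ∈ 𝓝 y ×ˢ 𝓟 K := by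
    rw [← nhdsSet_singleton]
    refine Filter.prod_mono le_rfl principal_le_nhdsSet ?_
    rw [← isCompact_singleton.nhdsSet_prod_eq hK, IsOpen.mem_nhdsSet
      (isOpen_lt hF.norm continuous_const)]
    exact fun p hp => (hM p hp).trans_lt (lt_add_one M)
  exact IsBigO.of_bound (M + 1) (by filter_upwards [hmem] with p hp; simpa using hp.le)

theorem isBigO_clm_apply {α X Y E : Type*} [NormedAddCommGroup X] [NormedSpace ℂ X]
    [NormedAddCommGroup Y] [NormedSpace ℂ Y] [NormedAddCommGroup E] {l : Filter α}
    {F : α → X →L[ℂ] Y} {v : α → X} {f : α → E} (hF : F =O[l] f)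
    (hv : v =O[l] fun _ => (1 : ℝ)) : (fun a => F a (v a)) =O[l] f :=
  have h : (fun a => F a (v a)) =O[l] fun a => ‖F a‖ * ‖v a‖ :=
    isBigO_of_le l fun a => ((F a).le_opNorm (v a)).trans (Real.le_norm_self _)
  h.trans (by simpa using hF.norm_norm.mul hv.norm_left)

variable {X : Type*} [NormedAddCommGroup X] [NormedSpace ℂ X]

theorem isLittleO_sub_smul_sub {C : ℂ → X} {x₀ : ℂ} (hC : ContinuousAt C x₀) :
    (fun x => (x - x₀) • (C x - C x₀)) =o[𝓝 x₀] fun x => x - x₀ := by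
  have h : (fun x => C x - C x₀) =o[𝓝 x₀] fun _ => (1 : ℂ) :=
    (isLittleO_one_iff ℂ).2 (tendsto_sub_nhds_zero_iff.2 hC)
  simpa using (isBigO_refl (fun x => x - x₀) (𝓝 x₀)).smul_isLittleO h

theorem isBigO_evolution_sub [CompleteSpace X] {ι F : Type*} [SeminormedAddCommGroup F]
    {l : Filter ι} {A : ι → ℝ → X →L[ℂ] X} {P R : ι → ℝ → X} {g : ι → F}
    (hA : ∀ i, Continuous (A i))
    (hAb : (fun p : ι × ℝ => A p.1 p.2) =O[l ×ˢ 𝓟 (Icc 0 1)] fun _ => (1 : ℝ))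
    (hP : ∀ i t, HasDerivAt (P i) (A i t (P i t) + R i t) t)
    (hR : (fun p : ι × ℝ => R p.1 p.2) =O[l ×ˢ 𝓟 (Icc 0 1)] fun p => g p.1) :
    (fun i => evolution (A i) 1 0 (P i 0) - P i 1) =O[l] g := by
  obtain ⟨K, hK⟩ := hAb.bound
  obtain ⟨M, hM⟩ := hR.bound
  rw [eventually_prod_principal_iff] at hK hM
  refine IsBigO.of_bound (gronwallBound 0 K 1 1 * M) ?_
  filter_upwards [hK, hM] with i hKi hMi
  rw [mul_assoc]
  exact norm_evolution_sub_le (hA i) (by simpa using hKi) (hP i) hMi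

theorem hasDerivAt_evolution_parameter [CompleteSpace X] {A : ℝ → X →L[ℂ] X}
    {C : ℂ → X →L[ℂ] X} {C' : X →L[ℂ] X} {x₀ : ℂ} (hA : Continuous A) (hCc : Continuous C)
    (hC : HasDerivAt C C' x₀) (y : X) {V : ℝ → X} (hV0 : V 0 = 0)
    (hV : ∀ t, HasDerivAt V
      ((A t + C x₀) (V t) + C' (evolution (fun t => A t + C x₀) t 0 y)) t) :
    HasDerivAt (fun x => evolution (fun t => A t + C x) 1 0 y) (V 1) x₀ := by
  have hA' : ∀ x, Continuous fun t => A t + C x := fun x => hA.add continuous_const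
  let S : ℝ → X := fun t => evolution (fun t => A t + C x₀) t 0 y
  have hS : Continuous S := continuous_evolution_apply (hA' x₀) y 0
  have hVc : Continuous V := continuous_iff_continuousAt.2 fun t => (hV t).continuousAt
  -- the first-order Taylor polynomial `S + (x - x₀) V` is an `o(x - x₀)`-approximate solution
  let R : ℂ → ℝ → X := fun x t =>
    -((C x - C x₀ - (x - x₀) • C') (S t)) - ((x - x₀) • (C x - C x₀)) (V t)
  let g : ℂ → ℝ := fun x => ‖C x - C x₀ - (x - x₀) • C'‖ + ‖(x - x₀) • (C x - C x₀)‖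
  have hR : (fun p : ℂ × ℝ => R p.1 p.2) =O[𝓝 x₀ ×ˢ 𝓟 (Icc 0 1)] fun p => g p.1 := by
    have hS1 := isBigO_one_of_continuous (F := fun p : ℂ × ℝ => S p.2) (by fun_prop) x₀
      (isCompact_Icc (a := 0) (b := 1))
    have hV1 := isBigO_one_of_continuous (F := fun p : ℂ × ℝ => V p.2) (by fun_prop) x₀
      (isCompact_Icc (a := 0) (b := 1))
    have hle₁ : (fun p : ℂ × ℝ => C p.1 - C x₀ - (p.1 - x₀) • C')
        =O[𝓝 x₀ ×ˢ 𝓟 (Icc 0 1)] fun p => g p.1 := isBigO_of_le _ fun p =>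
      (le_add_of_nonneg_right (norm_nonneg _)).trans (Real.le_norm_self (g p.1))
    have hle₂ : (fun p : ℂ × ℝ => (p.1 - x₀) • (C p.1 - C x₀))
        =O[𝓝 x₀ ×ˢ 𝓟 (Icc 0 1)] fun p => g p.1 := isBigO_of_le _ fun p =>
      (le_add_of_nonneg_left (norm_nonneg _)).trans (Real.le_norm_self (g p.1))
    exact (isBigO_clm_apply hle₁ hS1).neg_left.sub (isBigO_clm_apply hle₂ hV1)
  have hg : g =o[𝓝 x₀] fun x => x - x₀ :=
    (hasDerivAt_iff_isLittleO.1 hC).norm_left.add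
      (isLittleO_sub_smul_sub hC.continuousAt).norm_left
  have hP : ∀ x t, HasDerivAt (fun t => S t + (x - x₀) • V t)
      ((A t + C x) (S t + (x - x₀) • V t) + R x t) t := fun x t => by
    refine ((hasDerivAt_evolution_apply (hA' x₀) y t 0).add
      ((hV t).const_smul (x - x₀))).congr_deriv ?_
    simp only [R, S, add_apply, sub_apply, smul_apply, map_add, map_smul]
    module
  have hb := isBigO_one_of_continuous (F := fun p : ℂ × ℝ => A p.2 + C p.1) (by fun_prop) x₀
    (isCompact_Icc (a := 0) (b := 1))
  have key := (isBigO_evolution_sub hA' hb hP hR).trans_isLittleO hg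
  refine hasDerivAt_iff_isLittleO.2 (key.congr_left fun x => ?_)
  simp [S, hV0, evolution_self, sub_sub]

theorem differentiable_evolution [FiniteDimensional ℂ X] {A : ℝ → X →L[ℂ] X}
    {C : ℂ → X →L[ℂ] X} (hA : Continuous A) (hC : Differentiable ℂ C) :
    Differentiable ℂ fun x => evolution (fun t => A t + C x) 1 0 := by
  have : CompleteSpace X := FiniteDimensional.complete ℂ X
  suffices h : ∀ y, Differentiable ℂ fun x => evolution (fun t => A t + C x) 1 0 y from
    (contDiff_clm_apply_iff.2 fun y => (h y).contDiff (n := 1)).differentiable one_ne_zero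
  intro y x₀
  have hA' : Continuous fun t => A t + C x₀ := hA.add continuous_const
  have hS := continuous_evolution_apply hA' y 0
  obtain ⟨V, hV0, hV⟩ := exists_solution_inhomogeneous hA'
    (H := fun t => deriv C x₀ (evolution (fun t => A t + C x₀) t 0 y)) (by fun_prop)
  exact (hasDerivAt_evolution_parameter hA hC.continuous (hC x₀).hasDerivAt y hV0
    hV).differentiableAt

end Parameters

section SimpleEigenvector

variable {K V : Type*} [Field K] [AddCommGroup V] [Module K V] {S : Module.End K V} {z : K} {φ : V}

/-- `φ` is an eigenvector of `S` for an algebraically simple eigenvalue `z`. That `S φ = z φ` is a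
consequence, see `IsSimpleEigenvector.apply_eq`. -/
structure IsSimpleEigenvector (S : Module.End K V) (z : K) (φ : V) : Prop where
  ne_zero : φ ≠ 0
  maxGenEigenspace_eq : S.maxGenEigenspace z = Submodule.span K {φ}

namespace IsSimpleEigenvector

theorem mem_maxGenEigenspace_iff (h : IsSimpleEigenvector S z φ) {x : V} :
    x ∈ S.maxGenEigenspace z ↔ ∃ c : K, c • φ = x := by
  rw [h.maxGenEigenspace_eq, Submodule.mem_span_singleton]

theorem apply_eq (h : IsSimpleEigenvector S z φ) : S φ = z • φ := by
  have hφ : φ ∈ S.maxGenEigenspace z := h.mem_maxGenEigenspace_iff.2 ⟨1, one_smul K φ⟩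
  obtain ⟨c, hc⟩ := h.mem_maxGenEigenspace_iff.1
    (Module.End.mapsTo_maxGenEigenspace_of_comm
      (show Commute S (S - z • 1) by simp [Commute.sub_right, Commute.smul_right]) z hφ)
  obtain ⟨n, hn⟩ := (Module.End.mem_maxGenEigenspace _ _ _).1 hφ
  have hpow : ∀ n, ((S - z • 1) ^ n) φ = c ^ n • φ := fun n => by
    induction n with
    | zero => simp
    | succ n ih => rw [pow_succ, Module.End.mul_apply, ← hc, map_smul, ih, smul_smul, pow_succ']
  have hc0 : c = 0 := eq_zero_of_pow_eq_zero
    ((smul_eq_zero.1 ((hpow n).symm.trans hn)).resolve_right h.ne_zero)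
  rw [hc0, zero_smul] at hc
  simpa [sub_eq_zero] using hc.symm

theorem disjoint_range (h : IsSimpleEigenvector S z φ) :
    Disjoint (LinearMap.range (S - z • 1)) (Submodule.span K {φ}) := by
  have hφ : (S - z • 1) φ = 0 := by simp [h.apply_eq]
  rw [Submodule.disjoint_def]
  rintro _ ⟨x, rfl⟩ hx
  obtain ⟨c, hc⟩ := Submodule.mem_span_singleton.1 hx
  have hx2 : x ∈ S.maxGenEigenspace z := (Module.End.mem_maxGenEigenspace _ _ _).2
    ⟨2, by rw [pow_two, Module.End.mul_apply, ← hc, map_smul, hφ, smul_zero]⟩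
  obtain ⟨b, rfl⟩ := h.mem_maxGenEigenspace_iff.1 hx2
  rw [map_smul, hφ, smul_zero]

theorem isCompl_range [FiniteDimensional K V] (h : IsSimpleEigenvector S z φ) :
    IsCompl (LinearMap.range (S - z • 1)) (Submodule.span K {φ}) := by
  refine (Submodule.isCompl_iff_disjoint _ _ ?_).2 h.disjoint_range
  have hker : LinearMap.ker (S - z • 1) ≤ Submodule.span K {φ} := by
    rw [← h.maxGenEigenspace_eq]
    exact fun x hx => (Module.End.mem_maxGenEigenspace _ _ _).2 ⟨1, by simpa using hx⟩
  rw [← LinearMap.finrank_range_add_finrank_ker (S - z • 1)]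
  gcongr
  exact Submodule.finrank_mono hker

theorem exists_dual (h : IsSimpleEigenvector S z φ) :
    ∃ ℓ : Module.Dual K V, ℓ φ = 1 ∧ ∀ x, ℓ (S x) = z * ℓ x := by
  obtain ⟨ℓ, hℓφ, hℓ⟩ := Submodule.exists_le_ker_of_notMem fun hφ => h.ne_zero
    (Submodule.disjoint_def.1 h.disjoint_range φ hφ (Submodule.mem_span_singleton_self φ))
  refine ⟨(ℓ φ)⁻¹ • ℓ, inv_mul_cancel₀ hℓφ, fun x => ?_⟩
  have hx : ℓ (S x) = z * ℓ x := by
    simpa [sub_eq_zero] using hℓ (LinearMap.mem_range_self (S - z • 1) x)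
  simp only [LinearMap.smul_apply, smul_eq_mul, hx, mul_left_comm]

end IsSimpleEigenvector

end SimpleEigenvector

section Determinant

open scoped ContDiff

variable {X : Type*} [NormedAddCommGroup X] [NormedSpace ℂ X] [FiniteDimensional ℂ X]

theorem contDiff_det : ContDiff ℂ ω (ContinuousLinearMap.det : (X →L[ℂ] X) → ℂ) := by
  let b := Module.finBasis ℂ X
  have hdet : (ContinuousLinearMap.det : (X →L[ℂ] X) → ℂ) = fun T =>
      (Matrix.of fun i j => LinearMap.toContinuousLinearMap (b.coord i) (T (b j))).det := by
    funext T
    rw [ContinuousLinearMap.det, ← LinearMap.det_toMatrix b]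
    congr 1
    ext i j
    exact LinearMap.toMatrix_apply b b _ i j
  simp_rw [hdet, Matrix.det_apply]
  exact ContDiff.sum fun σ _ => ContDiff.const_smul _ (contDiff_prod fun i _ =>
    show ContDiff ℂ ω fun T : X →L[ℂ] X => LinearMap.toContinuousLinearMap (b.coord (σ i)) (T (b i))
    from (ContinuousLinearMap.contDiff _).comp (contDiff_id.clm_apply contDiff_const))

theorem exists_continuous_adjugate : ∃ adj : (X →L[ℂ] X) → X →L[ℂ] X,
    Continuous adj ∧ ∀ T x, adj T (T x) = T.det • x := by
  let b := Module.finBasis ℂ X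
  refine ⟨fun T => (Matrix.toLin b b
    (LinearMap.toMatrix b b (T : X →ₗ[ℂ] X)).adjugate).toContinuousLinearMap, ?_, fun T x => ?_⟩
  · have hM : Continuous fun T : X →L[ℂ] X => LinearMap.toMatrix b b (T : X →ₗ[ℂ] X) :=
      ((LinearMap.toMatrix b b).toLinearMap ∘ₗ
        ContinuousLinearMap.coeLM ℂ).continuous_of_finiteDimensional
    exact (LinearMap.toContinuousLinearMap.toLinearMap ∘ₗ
      (Matrix.toLin b b).toLinearMap).continuous_of_finiteDimensional.comp hM.matrix_adjugate
  · have h := Matrix.toLin_mul_apply b b b (LinearMap.toMatrix b b (T : X →ₗ[ℂ] X)).adjugate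
      (LinearMap.toMatrix b b (T : X →ₗ[ℂ] X)) x
    rw [Matrix.adjugate_mul, Matrix.toLin_toMatrix, LinearMap.det_toMatrix] at h
    simpa using h.symm

theorem isBigO_det_of_approx_kernel {ι F : Type*} [SeminormedAddCommGroup F] {l : Filter ι}
    {T : ι → X →L[ℂ] X} {T₀ : X →L[ℂ] X} {P : ι → X} {φ : X} {g : ι → F}
    (hT : Tendsto T l (𝓝 T₀)) (hP : Tendsto P l (𝓝 φ)) (hφ : φ ≠ 0)
    (hTP : (fun i => T i (P i)) =O[l] g) : (fun i => (T i).det) =O[l] g := by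
  obtain ⟨adj, hadj, hadj_mul⟩ := exists_continuous_adjugate (X := X)
  have hadj_one : (fun i => ‖adj (T i)‖) =O[l] fun _ => (1 : ℝ) :=
    ((hadj.tendsto T₀).comp hT).norm.isBigO_one ℝ
  have hsmul : (fun i => (T i).det • P i) =O[l] g := by
    refine IsBigO.trans (isBigO_of_le _ fun i => ?_)
      (by simpa using hadj_one.mul hTP.norm_norm : _ =O[l] g)
    rw [← hadj_mul, norm_mul, norm_norm, norm_norm]
    exact (adj (T i)).le_opNorm _
  have hone : (fun _ => (1 : ℂ)) =O[l] P := isBigO_const_left_iff_pos_le_norm one_ne_zero |>.2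
    ⟨‖φ‖ / 2, by positivity, (hP.norm.eventually_const_lt (by simpa using hφ)).mono fun _ h => h.le⟩
  refine IsBigO.trans ?_ hsmul
  simpa using (isBigO_refl (fun i => (T i).det) l).smul hone

end Determinant

section EigenvalueCurve

open scoped ContDiff

theorem exists_analytic_zero_curve {G : ℂ × ℂ → ℂ} {x₀ z₀ : ℂ} (hG : ContDiffAt ℂ ω G (x₀, z₀))
    (h0 : G (x₀, z₀) = 0) (hne : fderiv ℂ G (x₀, z₀) (0, 1) ≠ 0) :
    ∃ lam : ℂ → ℂ, AnalyticAt ℂ lam x₀ ∧ lam x₀ = z₀ ∧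
      ∀ᶠ q in 𝓝 (x₀, z₀), G q = 0 ↔ lam q.1 = q.2 := by
  have hinv : (fderiv ℂ G (x₀, z₀) ∘L .inr ℂ ℂ ℂ).IsInvertible :=
    ⟨ContinuousLinearEquiv.unitsEquivAut ℂ (Units.mk0 _ hne), by ext; simp⟩
  refine ⟨hG.implicitFunction (by simp) hinv,
    (hG.contDiffAt_implicitFunction (by simp) hinv).analyticAt,
    hG.implicitFunction_apply_self (by simp) hinv, ?_⟩
  simpa only [h0] using hG.eventually_apply_eq_iff_implicitFunction (by simp) hinv

theorem isBigO_sub_of_eq_zero {G : ℂ × ℂ → ℂ} {G' : ℂ × ℂ →L[ℂ] ℂ} {x₀ z₀ : ℂ}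
    (hG : HasStrictFDerivAt G G' (x₀, z₀)) (hne : G' (0, 1) ≠ 0) {ι : Type*} {l : Filter ι}
    {x z w : ι → ℂ} (hx : Tendsto x l (𝓝 x₀)) (hz : Tendsto z l (𝓝 z₀)) (hw : Tendsto w l (𝓝 z₀))
    (h0 : ∀ᶠ i in l, G (x i, w i) = 0) :
    (fun i => w i - z i) =O[l] fun i => G (x i, z i) := by
  have hlin : ∀ i, G' ((x i, w i) - (x i, z i)) = G' (0, 1) * (w i - z i) := fun i => by
    rw [show (x i, w i) - (x i, z i) = (w i - z i) • ((0, 1) : ℂ × ℂ) by simp, map_smul,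
      smul_eq_mul, mul_comm]
  have hsmall : (fun i => G (x i, w i) - G (x i, z i) - G' (0, 1) * (w i - z i))
      =o[l] fun i => w i - z i := by
    refine ((hG.isLittleO.comp_tendsto
      ((hx.prodMk_nhds hw).prodMk_nhds (hx.prodMk_nhds hz))).congr_left fun i => ?_).trans_isBigO
      (isBigO_of_le _ fun i => by simp [Prod.norm_def])
    rw [← hlin]
    rfl
  have hself : (fun i => w i - z i) =O[l] fun i => G' (0, 1) * (w i - z i) :=
    isBigO_self_const_mul hne _ _
  refine (hself.trans (hsmall.trans_isBigO hself).right_isBigO_add).trans ?_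
  refine IsBigO.congr' (f₁ := fun i => -G (x i, z i)) (isBigO_refl _ _).neg_left ?_ .rfl
  filter_upwards [h0] with i hi
  rw [hi]
  ring

variable {X : Type*} [NormedAddCommGroup X] [NormedSpace ℂ X] [FiniteDimensional ℂ X]

/-- The characteristic function `(x, z) ↦ det (z - S x)` of a family `S` of operators. -/
def charFun (S : ℂ → X →L[ℂ] X) (q : ℂ × ℂ) : ℂ := (q.2 • 1 - S q.1).det

variable {S : ℂ → X →L[ℂ] X}

theorem contDiff_charFun (hS : Differentiable ℂ S) : ContDiff ℂ ω (charFun S) := by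
  refine contDiff_det.comp ((contDiff_snd.smul contDiff_const).sub ?_)
  exact (contDiff_iff_contDiffAt.2 fun x => (hS.analyticAt x).contDiffAt).comp contDiff_fst

theorem charFun_eq_eval_charpoly (x z : ℂ) :
    charFun S (x, z) = (S x : X →ₗ[ℂ] X).charpoly.eval z := by
  rw [LinearMap.eval_charpoly]
  congr 1

theorem fderiv_charFun (hS : Differentiable ℂ S) (x z : ℂ) :
    fderiv ℂ (charFun S) (x, z) (0, 1) = (S x : X →ₗ[ℂ] X).charpoly.derivative.eval z := by
  have hslice := ((contDiff_charFun hS).differentiable (by simp) (x, z)).hasFDerivAt.comp_hasDerivAt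
    z ((hasDerivAt_const z x).prodMk (hasDerivAt_id z))
  simp only [Function.comp_def, charFun_eq_eval_charpoly] at hslice
  exact hslice.unique ((S x : X →ₗ[ℂ] X).charpoly.hasDerivAt z)

theorem mem_spectrum_iff_charFun {x z : ℂ} : z ∈ spectrum ℂ (S x) ↔ charFun S (x, z) = 0 := by
  rw [← AlgEquiv.spectrum_eq (Module.End.toContinuousLinearMap X).symm (S x),
    ← Module.End.hasEigenvalue_iff_mem_spectrum, Module.End.hasEigenvalue_iff_isRoot_charpoly,
    charFun_eq_eval_charpoly]
  rfl

theorem finrank_maxGenEigenspace_eq_one_iff (hS : Differentiable ℂ S) {x z : ℂ} :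
    Module.finrank ℂ (Module.End.maxGenEigenspace (S x : X →ₗ[ℂ] X) z) = 1 ↔
      charFun S (x, z) = 0 ∧ fderiv ℂ (charFun S) (x, z) (0, 1) ≠ 0 := by
  have hne : (S x : X →ₗ[ℂ] X).charpoly ≠ 0 := (LinearMap.charpoly_monic _).ne_zero
  have hpos := Polynomial.rootMultiplicity_pos hne (x := z)
  have hone := Polynomial.one_lt_rootMultiplicity_iff_isRoot hne (t := z)
  rw [LinearMap.finrank_maxGenEigenspace_eq, charFun_eq_eval_charpoly, fderiv_charFun hS,
    ← Polynomial.IsRoot.def, Ne, ← Polynomial.IsRoot.def]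
  grind

theorem isSimpleRoot_charFun (hS : Differentiable ℂ S) {x₀ z₀ : ℂ} {φ : X}
    (hφ : IsSimpleEigenvector (S x₀ : X →ₗ[ℂ] X) z₀ φ) :
    charFun S (x₀, z₀) = 0 ∧ fderiv ℂ (charFun S) (x₀, z₀) (0, 1) ≠ 0 := by
  rw [← finrank_maxGenEigenspace_eq_one_iff hS, hφ.maxGenEigenspace_eq,
    finrank_span_singleton hφ.ne_zero]

theorem exists_eigenvalue_curve (hS : Differentiable ℂ S) {x₀ z₀ : ℂ} {φ : X}
    (hφ : IsSimpleEigenvector (S x₀ : X →ₗ[ℂ] X) z₀ φ) :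
    ∃ ε > 0, ∃ lam : ℂ → ℂ, lam x₀ = z₀ ∧ ∀ᶠ x in 𝓝 x₀, AnalyticAt ℂ lam x ∧
      spectrum ℂ (S x) ∩ Metric.ball z₀ ε = {lam x} ∧
      Module.finrank ℂ (Module.End.maxGenEigenspace (S x : X →ₗ[ℂ] X) (lam x)) = 1 := by
  obtain ⟨hroot, hsimple⟩ := isSimpleRoot_charFun hS hφ
  obtain ⟨lam, hlam, hlam₀, hiff⟩ :=
    exists_analytic_zero_curve (contDiff_charFun hS).contDiffAt hroot hsimple
  have hderiv : ∀ᶠ q in 𝓝 (x₀, z₀), fderiv ℂ (charFun S) q (0, 1) ≠ 0 :=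
    (((contDiff_charFun hS).continuous_fderiv (by simp)).clm_apply
      continuous_const).continuousAt.eventually_ne hsimple
  obtain ⟨U, hU, V, hV, hUV⟩ := eventually_prod_iff.1
    (nhds_prod_eq (x := x₀) (y := z₀) ▸ hiff.and hderiv)
  obtain ⟨ε, hε, hball⟩ := Metric.eventually_nhds_iff.1 hV
  refine ⟨ε, hε, lam, hlam₀, ?_⟩
  filter_upwards [hU, hlam.eventually_analyticAt,
    hlam.continuousAt (by rw [hlam₀]; exact Metric.ball_mem_nhds z₀ hε)] with x hx hA hmem
  have hzero : charFun S (x, lam x) = 0 := (hUV hx (hball hmem)).1.2 rfl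
  refine ⟨hA, ?_, (finrank_maxGenEigenspace_eq_one_iff hS).2 ⟨hzero, (hUV hx (hball hmem)).2⟩⟩
  ext z
  rw [mem_inter_iff, mem_spectrum_iff_charFun, mem_singleton_iff]
  constructor
  · exact fun ⟨hz, hzε⟩ => ((hUV hx (hball hzε)).1.1 hz).symm
  · rintro rfl
    exact ⟨hzero, hmem⟩

theorem isBigO_eigenvalue_sub (hS : Differentiable ℂ S) {x₀ z₀ : ℂ} {φ : X}
    (hφ : IsSimpleEigenvector (S x₀ : X →ₗ[ℂ] X) z₀ φ) {ι F : Type*} [SeminormedAddCommGroup F]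
    {l : Filter ι} {x z w : ι → ℂ} {P : ι → X} {g : ι → F} (hx : Tendsto x l (𝓝 x₀))
    (hw : Tendsto w l (𝓝 z₀)) (hspec : ∀ᶠ i in l, w i ∈ spectrum ℂ (S (x i)))
    (hz : Tendsto z l (𝓝 z₀)) (hP : Tendsto P l (𝓝 φ))
    (hres : (fun i => S (x i) (P i) - z i • P i) =O[l] g) :
    (fun i => w i - z i) =O[l] g := by
  have hdet : (fun i => charFun S (x i, z i)) =O[l] g := by
    refine isBigO_det_of_approx_kernel
      (((continuous_snd.smul continuous_const).sub (hS.continuous.comp continuous_fst)).tendsto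
        (x₀, z₀) |>.comp (hx.prodMk_nhds hz)) hP hφ.ne_zero ?_
    simpa using hres.neg_left
  exact (isBigO_sub_of_eq_zero ((contDiff_charFun hS).contDiffAt.hasStrictFDerivAt (by simp))
    (isSimpleRoot_charFun hS hφ).2 hx hz hw
    (hspec.mono fun _ h => mem_spectrum_iff_charFun.1 h)).trans hdet

end EigenvalueCurve

section AdjointEquation

variable {X H : Type*} [NormedAddCommGroup X] [NormedSpace ℂ X] [NormedAddCommGroup H]
  [InnerProductSpace ℂ H]

/-- The linear equations `V' = A(t) V` and `W' = A'(t) W` are adjoint for the pairing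
`⟪e W, e V⟫`, that is `A'(t) = -A(t)*`. The space `X` is not required to be an inner product space,
since sequences of vectors carry the supremum norm. -/
def IsAdjointGenerator (e : X ≃L[ℂ] H) (A A' : ℝ → X →L[ℂ] X) : Prop :=
  ∀ t W V, ⟪e (A' t W), e V⟫_ℂ = -⟪e W, e (A t V)⟫_ℂ

namespace IsAdjointGenerator

variable {e : X ≃L[ℂ] H} {A A' : ℝ → X →L[ℂ] X} {W : ℝ → X}

theorem hasDerivAt_inner (hadj : IsAdjointGenerator e A A')
    (hW : ∀ t, HasDerivAt W (A' t (W t)) t) {V F : ℝ → X}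
    (hV : ∀ t, HasDerivAt V (A t (V t) + F t) t) (t : ℝ) :
    HasDerivAt (fun t => ⟪e (W t), e (V t)⟫_ℂ) ⟪e (W t), e (F t)⟫_ℂ t := by
  have he : ∀ {Z : ℝ → X} {z : X}, HasDerivAt Z z t → HasDerivAt (fun t => e (Z t)) (e z) t :=
    fun hZ => ((e : X →L[ℂ] H).restrictScalars ℝ).hasFDerivAt.comp_hasDerivAt t hZ
  refine ((he (hW t)).inner ℂ (he (hV t))).congr_deriv ?_
  rw [hadj, map_add, inner_add_right]
  abel

section CompleteSpace

variable [CompleteSpace X]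

theorem inner_evolution_apply (hadj : IsAdjointGenerator e A A') (hA : Continuous A)
    (hW : ∀ t, HasDerivAt W (A' t (W t)) t) (x : X) (t : ℝ) :
    ⟪e (W t), e (evolution A t 0 x)⟫_ℂ = ⟪e (W 0), e x⟫_ℂ := by
  have hd : ∀ t, HasDerivAt (fun t => ⟪e (W t), e (evolution A t 0 x)⟫_ℂ) 0 t := fun t => by
    simpa using hadj.hasDerivAt_inner hW (F := 0)
      (fun t => by simpa using hasDerivAt_evolution_apply hA x t 0) t
  simpa [evolution_self] using is_const_of_deriv_eq_zero (fun t => (hd t).differentiableAt)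
    (fun t => (hd t).deriv) t 0

theorem inner_eq_zero_of_mem_range (hadj : IsAdjointGenerator e A A') (hA : Continuous A)
    (hW : ∀ t, HasDerivAt W (A' t (W t)) t) (hWp : W 1 = W 0) {y : X}
    (hy : y ∈ LinearMap.range ((evolution A 1 0 : X →ₗ[ℂ] X) - (1 : ℂ) • 1)) :
    ⟪e (W 0), e y⟫_ℂ = 0 := by
  obtain ⟨x, rfl⟩ := hy
  have h := sub_eq_zero.2 (hadj.inner_evolution_apply hA hW x 1)
  simpa [hWp, map_sub, inner_sub_right] using h

end CompleteSpace

variable [FiniteDimensional ℂ X] {φ : X}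

theorem eq_zero_of_inner_eq_zero (hadj : IsAdjointGenerator e A A') (hA : Continuous A)
    (hA' : Continuous A') (hφ : IsSimpleEigenvector (evolution A 1 0 : X →ₗ[ℂ] X) 1 φ)
    (hW : ∀ t, HasDerivAt W (A' t (W t)) t) (hWp : W 1 = W 0)
    (h0 : ⟪e (W 0), e φ⟫_ℂ = 0) : W = 0 := by
  have : CompleteSpace X := FiniteDimensional.complete ℂ X
  have hW0 : ∀ y, ⟪e (W 0), e y⟫_ℂ = 0 := fun y => by
    obtain ⟨r, hr, z, hz, rfl⟩ := Submodule.mem_sup.1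
      (hφ.isCompl_range.sup_eq_top ▸ Submodule.mem_top : y ∈ _)
    obtain ⟨c, rfl⟩ := Submodule.mem_span_singleton.1 hz
    rw [map_add, inner_add_right, hadj.inner_eq_zero_of_mem_range hA hW hWp hr, map_smul,
      inner_smul_right, h0, mul_zero, add_zero]
  refine linearODE_unique hA' hW (fun t => ?_) (t₀ := 0) ?_
  · simp
  · simpa using hW0 (W 0)

theorem exists_normalized_periodic_solution (hadj : IsAdjointGenerator e A A')
    (hA : Continuous A) (hA' : Continuous A') (hA'p : Function.Periodic A' 1)
    (hφ : IsSimpleEigenvector (evolution A 1 0 : X →ₗ[ℂ] X) 1 φ) :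
    ∃ W : ℝ → X, (∀ t, HasDerivAt W (A' t (W t)) t) ∧ Function.Periodic W 1 ∧
      ⟪e (W 0), e φ⟫_ℂ = 1 := by
  have : CompleteSpace X := FiniteDimensional.complete ℂ X
  have : FiniteDimensional ℂ H := e.toLinearEquiv.finiteDimensional
  have : CompleteSpace H := FiniteDimensional.complete ℂ H
  obtain ⟨ℓ, hℓφ, hℓ⟩ := hφ.exists_dual
  obtain ⟨w, hw⟩ : ∃ w, ∀ x, ⟪e w, e x⟫_ℂ = ℓ x :=
    ⟨e.symm ((InnerProductSpace.toDual ℂ H).symm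
      (LinearMap.toContinuousLinearMap ℓ ∘L (e.symm : H →L[ℂ] X))), fun x => by simp⟩
  let W : ℝ → X := fun t => evolution A' t 0 w
  have hW : ∀ t, HasDerivAt W (A' t (W t)) t := fun t => hasDerivAt_evolution_apply hA' w t 0
  have hW0 : W 0 = w := by simp [W, evolution_self]
  have hsurj : Function.Surjective (evolution A 1 0 : X →ₗ[ℂ] X) :=
    LinearMap.injective_iff_surjective.1 (injective_evolution hA 1)
  have hW1 : W 1 = w := e.injective (ext_inner_right ℂ fun y => by
    obtain ⟨x, rfl⟩ := (e.surjective.comp hsurj) y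
    have hx : ℓ (evolution A 1 0 x) = ℓ x := by simpa using hℓ x
    simp only [Function.comp_apply, ContinuousLinearMap.coe_coe,
      hadj.inner_evolution_apply hA hW, hW0, hw, hx])
  exact ⟨W, hW, periodic_evolution_apply hA' hA'p hW1, by rw [hW0, hw, hℓφ]⟩

theorem exists_periodic_solution (hadj : IsAdjointGenerator e A A') (hA : Continuous A)
    (hφ : IsSimpleEigenvector (evolution A 1 0 : X →ₗ[ℂ] X) 1 φ)
    (hW : ∀ t, HasDerivAt W (A' t (W t)) t) (hWp : W 1 = W 0) (hWφ : ⟪e (W 0), e φ⟫_ℂ ≠ 0)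
    {F : ℝ → X} (hF : Continuous F) (h0 : ∫ t in (0 : ℝ)..1, ⟪e (W t), e (F t)⟫_ℂ = 0) :
    ∃ V : ℝ → X, V 1 = V 0 ∧ ∀ t, HasDerivAt V (A t (V t) + F t) t := by
  have : CompleteSpace X := FiniteDimensional.complete ℂ X
  obtain ⟨V, hV0, hV⟩ := exists_solution_inhomogeneous hA hF
  obtain ⟨r, ⟨x, rfl⟩, z, hz, hrz⟩ := Submodule.mem_sup.1
    (hφ.isCompl_range.sup_eq_top ▸ Submodule.mem_top : V 1 ∈ _)
  obtain ⟨c, rfl⟩ := Submodule.mem_span_singleton.1 hz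
  have hWc : Continuous W := continuous_iff_continuousAt.2 fun t => (hW t).continuousAt
  have hV1 : ⟪e (W 1), e (V 1)⟫_ℂ = 0 := by
    rw [intervalIntegral.integral_eq_sub_of_hasDerivAt (fun t _ => hadj.hasDerivAt_inner hW hV t)
      (Continuous.intervalIntegrable (by fun_prop) _ _)] at h0
    simpa [hV0] using h0
  have hc : c = 0 := by
    rw [hWp, ← hrz, map_add, inner_add_right,
      hadj.inner_eq_zero_of_mem_range hA hW hWp (LinearMap.mem_range_self _ x), zero_add, map_smul,
      inner_smul_right] at hV1
    exact (mul_eq_zero.1 hV1).resolve_right hWφ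
  refine ⟨fun t => V t - evolution A t 0 x, ?_, fun t => ?_⟩
  · simp [hV0, evolution_self, ← hrz, hc]
  · refine ((hV t).sub (hasDerivAt_evolution_apply hA x t 0)).congr_deriv ?_
    rw [map_sub]; abel

end IsAdjointGenerator

end AdjointEquation

section FloquetExpansion

variable {X : Type*} [NormedAddCommGroup X] [NormedSpace ℂ X] {A : ℝ → X →L[ℂ] X}
  {B₁ B₂ : X →L[ℂ] X} {φ V₁ V₂ : ℝ → X} {ν₁ ν₂ : ℂ}

theorem hasDerivAt_formal_eigenpair (C : X →L[ℂ] X) (hφ : ∀ t, HasDerivAt φ (A t (φ t)) t)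
    (hV₁ : ∀ t, HasDerivAt V₁ (A t (V₁ t) + (B₁ (φ t) - ν₁ • φ t)) t)
    (hV₂ : ∀ t, HasDerivAt V₂ (A t (V₂ t) + (B₁ (V₁ t) + B₂ (φ t) - ν₂ • φ t - ν₁ • V₁ t)) t)
    (x : ℂ) (t : ℝ) :
    HasDerivAt
      (fun t : ℝ => Complex.exp ((ν₁ * x + ν₂ * x ^ 2) * t) • (φ t + x • V₁ t + x ^ 2 • V₂ t))
      ((A t + C) (Complex.exp ((ν₁ * x + ν₂ * x ^ 2) * t) • (φ t + x • V₁ t + x ^ 2 • V₂ t)) +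
        Complex.exp ((ν₁ * x + ν₂ * x ^ 2) * t) •
          (x ^ 3 • (ν₁ • V₂ t + ν₂ • V₁ t - B₁ (V₂ t) - B₂ (V₁ t) +
              x • (ν₂ • V₂ t - B₂ (V₂ t))) -
            (C - x • B₁ - x ^ 2 • B₂) (φ t + x • V₁ t + x ^ 2 • V₂ t))) t := by
  have hexp : HasDerivAt (fun t : ℝ => Complex.exp ((ν₁ * x + ν₂ * x ^ 2) * t))
      (Complex.exp ((ν₁ * x + ν₂ * x ^ 2) * t) * (ν₁ * x + ν₂ * x ^ 2)) t := by
    simpa using ((hasDerivAt_id (t : ℂ)).const_mul (ν₁ * x + ν₂ * x ^ 2)).cexp.comp_ofReal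
  have hQ : HasDerivAt (fun t => φ t + x • V₁ t + x ^ 2 • V₂ t) _ t :=
    ((hφ t).add ((hV₁ t).const_smul x)).add ((hV₂ t).const_smul (x ^ 2))
  refine (hexp.smul hQ).congr_deriv ?_
  simp only [add_apply, sub_apply, smul_apply, map_add, map_smul]
  module

theorem isBigO_evolution_formal_eigenpair [CompleteSpace X] (hA : Continuous A)
    {C : ℂ → X →L[ℂ] X} (hCc : Continuous C)
    (hC : (fun x => C x - x • B₁ - x ^ 2 • B₂) =O[𝓝 0] fun x => x ^ 3)
    (hφ : ∀ t, HasDerivAt φ (A t (φ t)) t)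
    (hV₁ : ∀ t, HasDerivAt V₁ (A t (V₁ t) + (B₁ (φ t) - ν₁ • φ t)) t)
    (hV₂ : ∀ t, HasDerivAt V₂ (A t (V₂ t) + (B₁ (V₁ t) + B₂ (φ t) - ν₂ • φ t - ν₁ • V₁ t)) t)
    (hφp : φ 1 = φ 0) (hV₁p : V₁ 1 = V₁ 0) (hV₂p : V₂ 1 = V₂ 0) :
    (fun x => evolution (fun t => A t + C x) 1 0 (φ 0 + x • V₁ 0 + x ^ 2 • V₂ 0) -
      Complex.exp (ν₁ * x + ν₂ * x ^ 2) • (φ 0 + x • V₁ 0 + x ^ 2 • V₂ 0))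
      =O[𝓝 0] fun x => x ^ 3 := by
  have hφc : Continuous φ := continuous_iff_continuousAt.2 fun t => (hφ t).continuousAt
  have hV₁c : Continuous V₁ := continuous_iff_continuousAt.2 fun t => (hV₁ t).continuousAt
  have hV₂c : Continuous V₂ := continuous_iff_continuousAt.2 fun t => (hV₂ t).continuousAt
  let e : ℂ × ℝ → ℂ := fun p => Complex.exp ((ν₁ * p.1 + ν₂ * p.1 ^ 2) * p.2)
  let Q : ℂ × ℝ → X := fun p => φ p.2 + p.1 • V₁ p.2 + p.1 ^ 2 • V₂ p.2
  let G : ℂ × ℝ → X := fun p => ν₁ • V₂ p.2 + ν₂ • V₁ p.2 - B₁ (V₂ p.2) - B₂ (V₁ p.2) +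
    p.1 • (ν₂ • V₂ p.2 - B₂ (V₂ p.2))
  have he := isBigO_one_of_continuous (F := e) (by fun_prop) 0 (isCompact_Icc (a := 0) (b := 1))
  have hG := isBigO_one_of_continuous (F := G) (by fun_prop) 0 (isCompact_Icc (a := 0) (b := 1))
  have hQ := isBigO_one_of_continuous (F := Q) (by fun_prop) 0 (isCompact_Icc (a := 0) (b := 1))
  have hb := isBigO_one_of_continuous (F := fun p : ℂ × ℝ => A p.2 + C p.1) (by fun_prop) 0
    (isCompact_Icc (a := 0) (b := 1))
  have hGx : (fun p => p.1 ^ 3 • G p) =O[𝓝 0 ×ˢ 𝓟 (Icc 0 1)] fun p => ‖p.1 ^ 3‖ := by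
    simpa only [smul_eq_mul, mul_one] using
      ((isBigO_refl (fun p : ℂ × ℝ => p.1 ^ 3) _).norm_right).smul hG
  have hDQ : (fun p => (C p.1 - p.1 • B₁ - p.1 ^ 2 • B₂) (Q p))
      =O[𝓝 0 ×ˢ 𝓟 (Icc 0 1)] fun p => ‖p.1 ^ 3‖ :=
    isBigO_clm_apply (hC.comp_tendsto tendsto_fst).norm_right hQ
  have hR := he.smul (hGx.sub hDQ)
  simp only [smul_eq_mul, one_mul] at hR
  have key := isBigO_evolution_sub (A := fun x t => A t + C x) (fun x => hA.add continuous_const) hb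
    (fun x => hasDerivAt_formal_eigenpair (C x) hφ hV₁ hV₂ x) (g := fun x => ‖x ^ 3‖) hR
  simpa only [hφp, hV₁p, hV₂p, Complex.ofReal_zero, Complex.ofReal_one, mul_zero, mul_one,
    Complex.exp_zero, one_smul] using key.of_norm_right

end FloquetExpansion

section PhaseJacobian

variable {d : ℕ}

/-- The Jacobian along the profile for the phase variable `ζ = ω t` in place of time. -/
def phaseJac (f : (Fin d → ℝ) → Fin d → ℝ) (u : ℝ → Fin d → ℝ) (ω ζ : ℝ) :
    Matrix (Fin d) (Fin d) ℂ :=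
  (ω : ℂ)⁻¹ • jac f (u ζ)

theorem conjTranspose_phaseJac (f : (Fin d → ℝ) → Fin d → ℝ) (u : ℝ → Fin d → ℝ) (ω ζ : ℝ) :
    (phaseJac f u ω ζ)ᴴ = (ω : ℂ)⁻¹ • (jac f (u ζ))ᵀ := by
  ext a b
  simp [phaseJac, jac]

theorem continuous_jac {f : (Fin d → ℝ) → Fin d → ℝ} {u : ℝ → Fin d → ℝ}
    (hf : ContDiff ℝ 1 f) (hu : Continuous u) : Continuous fun ζ => jac f (u ζ) := by
  have hfderiv : Continuous fun ζ => fderiv ℝ f (u ζ) := (hf.continuous_fderiv one_ne_zero).comp hu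
  exact continuous_matrix fun a b => Complex.continuous_ofReal.comp
    ((continuous_apply a).comp (hfderiv.clm_apply continuous_const))

theorem continuous_phaseJac {f : (Fin d → ℝ) → Fin d → ℝ} {u : ℝ → Fin d → ℝ}
    (hf : ContDiff ℝ 1 f) (hu : Continuous u) (ω : ℝ) : Continuous (phaseJac f u ω) :=
  (continuous_jac hf hu).const_smul (ω : ℂ)⁻¹

theorem periodic_phaseJac (f : (Fin d → ℝ) → Fin d → ℝ) {u : ℝ → Fin d → ℝ}
    (hu : Function.Periodic u 1) (ω : ℝ) : Function.Periodic (phaseJac f u ω) 1 := fun ζ => by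
  simp only [phaseJac, hu ζ]

end PhaseJacobian

section LatticeOperators

variable {d : ℕ} (N : ℕ)

/-- The shift `V ↦ V (· + m)` of `N`-periodic sequences. -/
def shift (m : ZMod N) : (ZMod N → Fin d → ℂ) →L[ℂ] (ZMod N → Fin d → ℂ) :=
  ContinuousLinearMap.pi fun j => ContinuousLinearMap.proj (j + m)

/-- Multiplication of `N`-periodic sequences by the samples `J (t + j / N)` of a matrix function. -/
def sampledPotential (J : ℝ → Matrix (Fin d) (Fin d) ℂ) (t : ℝ) :
    (ZMod N → Fin d → ℂ) →L[ℂ] (ZMod N → Fin d → ℂ) :=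
  ContinuousLinearMap.pi fun j =>
    (J (t + j.val / N)).mulVecLin.toContinuousLinearMap ∘L ContinuousLinearMap.proj j

/-- The generator `V ↦ c (V (· + 1) - 2 V + V (· - 1)) + J (t + · / N) V` on `N`-periodic
sequences. -/
def latticeGenerator (c : ℂ) (J : ℝ → Matrix (Fin d) (Fin d) ℂ) (t : ℝ) :
    (ZMod N → Fin d → ℂ) →L[ℂ] (ZMod N → Fin d → ℂ) :=
  c • (shift N 1 - (2 : ℂ) • 1 + shift N (-1)) + sampledPotential N J t

/-- The difference of the Bloch symbols of `c (V (· + 1) - 2 V + V (· - 1))` at the complex Floquet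
exponents `-i x` and `0`. -/
def blochPerturbation (c x : ℂ) : (ZMod N → Fin d → ℂ) →L[ℂ] (ZMod N → Fin d → ℂ) :=
  (c * (Complex.exp x - 1)) • shift N 1 + (c * (Complex.exp (-x) - 1)) • shift N (-1)

@[simp] theorem shift_apply (m : ZMod N) (V : ZMod N → Fin d → ℂ) (j : ZMod N) :
    shift N m V j = V (j + m) := rfl

@[simp] theorem sampledPotential_apply (J : ℝ → Matrix (Fin d) (Fin d) ℂ) (t : ℝ)
    (V : ZMod N → Fin d → ℂ) (j : ZMod N) :
    sampledPotential N J t V j = J (t + j.val / N) *ᵥ V j := rfl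

theorem latticeGenerator_apply (c : ℂ) (J : ℝ → Matrix (Fin d) (Fin d) ℂ) (t : ℝ)
    (V : ZMod N → Fin d → ℂ) (j : ZMod N) :
    latticeGenerator N c J t V j =
      c • (V (j + 1) - (2 : ℂ) • V j + V (j - 1)) + J (t + j.val / N) *ᵥ V j := by
  simp [latticeGenerator, sub_eq_add_neg]

theorem periodic_latticeGenerator (c : ℂ) {J : ℝ → Matrix (Fin d) (Fin d) ℂ}
    (hJ : Function.Periodic J 1) : Function.Periodic (latticeGenerator N c J) 1 := by
  intro t
  ext V j : 2
  rw [latticeGenerator_apply, latticeGenerator_apply, add_right_comm, hJ]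

theorem smul_latticeGenerator (a c : ℂ) (J : ℝ → Matrix (Fin d) (Fin d) ℂ) (t : ℝ) :
    a • latticeGenerator N c J t = latticeGenerator N (a * c) (a • J) t := by
  ext V j : 2
  simp only [smul_apply, Pi.smul_apply, latticeGenerator_apply, Matrix.smul_mulVec, smul_add,
    mul_smul]

theorem smul_blochPerturbation (a c x : ℂ) :
    a • blochPerturbation (d := d) N c x = blochPerturbation N (a * c) x := by
  simp only [blochPerturbation, smul_add, smul_smul, mul_assoc]

theorem blochPerturbation_zero (c : ℂ) : blochPerturbation (d := d) N c 0 = 0 := by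
  simp only [blochPerturbation, neg_zero, Complex.exp_zero, sub_self, mul_zero]
  module

variable [NeZero N]

theorem continuous_latticeGenerator (c : ℂ) {J : ℝ → Matrix (Fin d) (Fin d) ℂ}
    (hJ : Continuous J) : Continuous (latticeGenerator N c J) := by
  refine continuous_const.add (continuous_clm_apply.2 fun V => continuous_pi fun j => ?_)
  exact (hJ.comp (continuous_add_const _)).matrix_mulVec continuous_const

theorem differentiable_blochPerturbation (c : ℂ) :
    Differentiable ℂ (blochPerturbation (d := d) N c) := by
  unfold blochPerturbation
  fun_prop

theorem isBigO_blochPerturbation_sub (c : ℂ) :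
    (fun x => blochPerturbation (d := d) N c x - x • (c • (shift N 1 - shift N (-1))) -
      x ^ 2 • ((c / 2) • (shift N 1 + shift N (-1)))) =O[𝓝 0] fun x => x ^ 3 := by
  have hexp : (fun x : ℂ => Complex.exp x - 1 - x - x ^ 2 / 2) =O[𝓝 0] fun x => x ^ 3 := by
    refine (Complex.exp_sub_sum_range_isBigO_pow 3).congr_left fun x => ?_
    simp only [Finset.sum_range_succ, Finset.sum_range_zero, Nat.factorial]
    push_cast
    ring
  have hexp_neg : (fun x : ℂ => Complex.exp (-x) - 1 + x - x ^ 2 / 2) =O[𝓝 0] fun x => x ^ 3 := by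
    have hneg : Tendsto (fun x : ℂ => -x) (𝓝 0) (𝓝 0) := by
      simpa using (tendsto_id (x := 𝓝 (0 : ℂ))).neg
    refine ((hexp.comp_tendsto hneg).trans (isBigO_of_le _ fun x => by simp)).congr_left ?_
    intro x
    simp only [Function.comp_apply]
    ring
  have hsmul : ∀ {r : ℂ → ℂ} (B : (ZMod N → Fin d → ℂ) →L[ℂ] (ZMod N → Fin d → ℂ)),
      r =O[𝓝 0] (fun x => x ^ 3) → (fun x => (c * r x) • B) =O[𝓝 0] fun x => x ^ 3 :=
    fun B hr => by
      simpa using (hr.const_mul_left c).smul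
        (isBigO_const_const B (one_ne_zero (α := ℂ)) (𝓝 (0 : ℂ)))
  refine ((hsmul (shift N 1) hexp).add (hsmul (shift N (-1)) hexp_neg)).congr_left fun x => ?_
  simp only [blochPerturbation]
  module

theorem blochSymbol_linearization (μ : ℝ) (f : (Fin d → ℝ) → Fin d → ℝ) (u : ℝ → Fin d → ℝ)
    (ω t ξ : ℝ) :
    blochSymbol N ξ (linearization μ f u (1 / N) ω t) =
      latticeGenerator N μ (fun ζ => jac f (u ζ)) (ω * t) +
        blochPerturbation N μ (Complex.I * ξ) := by
  ext V j : 2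
  have hright : Complex.exp (-(Complex.I * (j.val : ℂ) * ξ)) *
      Complex.exp (Complex.I * ((j.val : ℂ) + 1) * ξ) = Complex.exp (Complex.I * ξ) := by
    rw [← Complex.exp_add]; ring_nf
  have hleft : Complex.exp (-(Complex.I * (j.val : ℂ) * ξ)) *
      Complex.exp (Complex.I * ((j.val : ℂ) - 1) * ξ) = Complex.exp (-(Complex.I * ξ)) := by
    rw [← Complex.exp_add]; ring_nf
  have hcancel : Complex.exp (-(Complex.I * (j.val : ℂ) * ξ)) *
      Complex.exp (Complex.I * (j.val : ℂ) * ξ) = 1 := by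
    rw [← Complex.exp_add, neg_add_cancel, Complex.exp_zero]
  have hphase : 1 / (N : ℝ) * ((j.val : ℤ) : ℝ) + ω * t = ω * t + j.val / N := by
    push_cast; ring
  change Complex.exp (-(Complex.I * (j.val : ℂ) * ξ)) •
    linearization μ f u (1 / N) ω t (modulate N ξ V) (j.val : ℤ) = _
  simp only [linearization, modulate, LinearMap.coe_mk, AddHom.coe_mk, add_apply, Pi.add_apply,
    latticeGenerator_apply, blochPerturbation, smul_apply, Pi.smul_apply, shift_apply, hphase,
    Matrix.mulVec_smul, ← sub_eq_add_neg]
  push_cast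
  rw [← hright, ← hleft, ZMod.natCast_zmod_val]
  linear_combination (norm := module) hcancel •
    (((-2 : ℂ) * (μ : ℂ)) • V j + jac f (u (ω * t + (j.val : ℝ) / N)) *ᵥ V j)

/-- The one-period Floquet operator at the complex Floquet exponent `-i x`, in the phase variable
`ζ = ω t`. -/
def complexFloquet (c : ℂ) (J : ℝ → Matrix (Fin d) (Fin d) ℂ) (x : ℂ) :
    (ZMod N → Fin d → ℂ) →L[ℂ] (ZMod N → Fin d → ℂ) :=
  evolution (fun t => latticeGenerator N c J t + blochPerturbation N c x) 1 0

theorem complexFloquet_zero (c : ℂ) (J : ℝ → Matrix (Fin d) (Fin d) ℂ) :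
    complexFloquet N c J 0 = evolution (latticeGenerator N c J) 1 0 := by
  simp only [complexFloquet, blochPerturbation_zero, add_zero]

theorem differentiable_complexFloquet (c : ℂ) {J : ℝ → Matrix (Fin d) (Fin d) ℂ}
    (hJ : Continuous J) : Differentiable ℂ (complexFloquet N c J) :=
  differentiable_evolution (continuous_latticeGenerator N c hJ)
    (differentiable_blochPerturbation N c)

theorem floquet_eq_complexFloquet {f : (Fin d → ℝ) → Fin d → ℝ} {u : ℝ → Fin d → ℝ} {ω : ℝ}
    (hω : ω ≠ 0) (hf : ContDiff ℝ 1 f) (hu : Continuous u) (μ ξ : ℝ) :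
    floquet N μ f u ω ξ =
      complexFloquet N ((μ / ω : ℝ) : ℂ) (phaseJac f u ω) (Complex.I * ξ) := by
  have hA : Continuous fun t => latticeGenerator N μ (fun ζ => jac f (u ζ)) (ω * t) +
      blochPerturbation N μ (Complex.I * ξ) :=
    ((continuous_latticeGenerator N μ (continuous_jac hf hu)).comp (continuous_const_mul ω)).add
      continuous_const
  have hscale := evolution_comp_mul hA ω⁻¹ 1
  simp only [mul_one, mul_inv_cancel_left₀ hω, smul_add, smul_latticeGenerator,
    smul_blochPerturbation] at hscale
  simp only [← Complex.ofReal_mul, inv_mul_eq_div] at hscale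
  simp only [floquet, blochSymbol_linearization]
  rw [one_div, ← hscale, Complex.ofReal_inv]
  rfl

end LatticeOperators

section LatticeInnerProduct

variable {d : ℕ} (N : ℕ) [NeZero N]

/-- The identification of `N`-periodic sequences, normed by the supremum, with the Hilbert space of
square-summable ones. -/
def latticeHilbert (d : ℕ) : (ZMod N → Fin d → ℂ) ≃L[ℂ]
    PiLp 2 fun _ : ZMod N => EuclideanSpace ℂ (Fin d) :=
  (ContinuousLinearEquiv.piCongrRight fun _ => (EuclideanSpace.equiv (Fin d) ℂ).symm).trans
    (PiLp.continuousLinearEquiv 2 ℂ fun _ : ZMod N => EuclideanSpace ℂ (Fin d)).symm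

theorem inner_latticeHilbert (W V : ZMod N → Fin d → ℂ) :
    ⟪latticeHilbert N d W, latticeHilbert N d V⟫_ℂ = ∑ j, star (W j) ⬝ᵥ V j := by
  simp only [PiLp.inner_apply, dotProduct_comm (star _)]
  rfl

theorem inner_shift (m : ZMod N) (W V : ZMod N → Fin d → ℂ) :
    ⟪latticeHilbert N d (shift N m W), latticeHilbert N d V⟫_ℂ =
      ⟪latticeHilbert N d W, latticeHilbert N d (shift N (-m) V)⟫_ℂ := by
  rw [inner_latticeHilbert, inner_latticeHilbert, ← Equiv.sum_comp (Equiv.subRight m)]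
  simp [sub_eq_add_neg]

theorem inner_sampledPotential_conjTranspose (J : ℝ → Matrix (Fin d) (Fin d) ℂ) (t : ℝ)
    (W V : ZMod N → Fin d → ℂ) :
    ⟪latticeHilbert N d (sampledPotential N (fun ζ => (J ζ)ᴴ) t W), latticeHilbert N d V⟫_ℂ =
      ⟪latticeHilbert N d W, latticeHilbert N d (sampledPotential N J t V)⟫_ℂ := by
  simp only [inner_latticeHilbert, sampledPotential_apply, Matrix.star_mulVec,
    Matrix.conjTranspose_conjTranspose, Matrix.dotProduct_mulVec]

theorem isAdjointGenerator_latticeGenerator (c : ℂ) (J : ℝ → Matrix (Fin d) (Fin d) ℂ) :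
    IsAdjointGenerator (latticeHilbert N d) (latticeGenerator N c J)
      (latticeGenerator N (-conj c) fun ζ => -(J ζ)ᴴ) := by
  intro t W V
  have hneg : sampledPotential N (fun ζ => -(J ζ)ᴴ) t W =
      -sampledPotential N (fun ζ => (J ζ)ᴴ) t W := by
    funext j
    simp only [sampledPotential_apply, Matrix.neg_mulVec, Pi.neg_apply]
  simp only [latticeGenerator, add_apply, sub_apply, smul_apply, one_apply_eq_self, map_add,
    map_sub, map_smul, inner_add_left, inner_add_right, inner_sub_left, inner_sub_right,
    inner_smul_left, inner_smul_right, hneg, map_neg, inner_neg_left, inner_shift, neg_neg,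
    inner_sampledPotential_conjTranspose, Complex.conj_conj, Complex.conj_ofNat]
  ring

end LatticeInnerProduct

section Sampling

variable {d : ℕ} (N : ℕ)

/-- The operator `h ↦ c (h(· + k) - 2 h + h(· - k)) + J h` on functions of the phase. -/
def advanceDelayOp (c : ℂ) (k : ℝ) (J : ℝ → Matrix (Fin d) (Fin d) ℂ) (h : ℝ → Fin d → ℂ)
    (ζ : ℝ) : Fin d → ℂ :=
  c • (h (ζ + k) - (2 : ℂ) • h ζ + h (ζ - k)) + J ζ *ᵥ h ζ

/-- The `N`-periodic sequence of samples `h(t + j/N)` of a `1`-periodic function. -/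
def sample (h : ℝ → Fin d → ℂ) (t : ℝ) : ZMod N → Fin d → ℂ := fun j => h (t + j.val / N)

/-- The function `t ↦ ∑ j, W_j(t - j/N)`; up to integration over a period, `unsample` is the
transpose of `sample`. -/
def unsample [NeZero N] (W : ℝ → ZMod N → Fin d → ℂ) (t : ℝ) : Fin d → ℂ :=
  ∑ j : ZMod N, W (t - j.val / N) j

theorem periodic_sample {h : ℝ → Fin d → ℂ} (hh : Function.Periodic h 1) :
    Function.Periodic (sample N h) 1 := by
  intro t
  funext j
  rw [sample, sample, add_right_comm, hh]

theorem continuous_sample {h : ℝ → Fin d → ℂ} (hh : Continuous h) : Continuous (sample N h) :=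
  continuous_pi fun _ => hh.comp (continuous_add_const _)

theorem hasDerivAt_sample {h h' : ℝ → Fin d → ℂ} (hh : ∀ ζ, HasDerivAt h (h' ζ) ζ) (t : ℝ) :
    HasDerivAt (sample N h) (sample N h' t) t :=
  hasDerivAt_pi.2 fun j => (hh (t + j.val / N)).comp_add_const t (j.val / N)

variable [NeZero N]

theorem periodic_unsample {W : ℝ → ZMod N → Fin d → ℂ} (hW : Function.Periodic W 1) :
    Function.Periodic (unsample N W) 1 := by
  intro t
  refine Finset.sum_congr rfl fun j _ => ?_
  rw [add_sub_right_comm, hW]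

theorem hasDerivAt_unsample {W W' : ℝ → ZMod N → Fin d → ℂ}
    (hW : ∀ t, HasDerivAt W (W' t) t) (ζ : ℝ) :
    HasDerivAt (unsample N W) (unsample N W' ζ) ζ :=
  HasDerivAt.fun_sum fun j _ =>
    (hasDerivAt_pi.1 (hW (ζ - j.val / N)) j).comp_sub_const ζ (j.val / N)

variable {N}

theorem exists_val_add_intCast_div_eq (j : ZMod N) (m : ℤ) :
    ∃ n : ℤ, ((j + m).val : ℝ) / N = j.val / N + m / N + n := by
  have hmod : (((j.val : ℤ) + m : ℤ) : ZMod N) = (((j + m).val : ℤ) : ZMod N) := by simp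
  obtain ⟨n, hn⟩ := (ZMod.intCast_eq_intCast_iff_dvd_sub _ _ _).1 hmod
  refine ⟨n, ?_⟩
  have hN : (N : ℝ) ≠ 0 := Nat.cast_ne_zero.2 (NeZero.ne N)
  have hn' : ((j + m).val : ℝ) - (j.val + m) = N * n := by exact_mod_cast hn
  field_simp
  linarith

theorem shift_sample {h : ℝ → Fin d → ℂ} (hh : Function.Periodic h 1) (m : ℤ) (t : ℝ) :
    shift N m (sample N h t) = sample N h (t + m / N) := by
  funext j
  obtain ⟨n, hn⟩ := exists_val_add_intCast_div_eq j m
  rw [shift_apply, sample, sample, hn, ← mul_one (n : ℝ), ← add_assoc, hh.int_mul n]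
  ring_nf

theorem shift_one_sample {h : ℝ → Fin d → ℂ} (hh : Function.Periodic h 1) (t : ℝ) :
    shift N 1 (sample N h t) = sample N (fun ζ => h (ζ + 1 / N)) t := by
  funext j
  simpa [sample, add_right_comm] using congrFun (shift_sample (N := N) hh 1 t) j

theorem shift_neg_one_sample {h : ℝ → Fin d → ℂ} (hh : Function.Periodic h 1) (t : ℝ) :
    shift N (-1) (sample N h t) = sample N (fun ζ => h (ζ - 1 / N)) t := by
  funext j
  simpa [sample, add_right_comm, sub_eq_add_neg, neg_div] using
    congrFun (shift_sample (N := N) hh (-1) t) j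

theorem unsample_shift {W : ℝ → ZMod N → Fin d → ℂ} (hW : Function.Periodic W 1) (m : ℤ)
    (ζ : ℝ) : unsample N (fun t => shift N m (W t)) ζ = unsample N W (ζ + m / N) := by
  refine Eq.trans (Finset.sum_congr rfl fun j _ => ?_)
    (Equiv.sum_comp (Equiv.addRight (m : ZMod N)) fun j => W (ζ + m / N - j.val / N) j)
  obtain ⟨n, hn⟩ := exists_val_add_intCast_div_eq j m
  have hphase : ζ - j.val / N = ζ + m / N - ((j + m).val : ℝ) / N + n * 1 := by rw [hn]; ring
  change W (ζ - j.val / N) (j + m) = _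
  rw [hphase, hW.int_mul n]
  rfl

theorem latticeGenerator_sample (c : ℂ) (J : ℝ → Matrix (Fin d) (Fin d) ℂ) {h : ℝ → Fin d → ℂ}
    (hh : Function.Periodic h 1) (t : ℝ) :
    latticeGenerator N c J t (sample N h t) = sample N (advanceDelayOp c (1 / N) J h) t := by
  simp only [latticeGenerator, add_apply, sub_apply, smul_apply, shift_one_sample hh,
    shift_neg_one_sample hh]
  rfl

theorem unsample_latticeGenerator (c : ℂ) (J : ℝ → Matrix (Fin d) (Fin d) ℂ)
    {W : ℝ → ZMod N → Fin d → ℂ} (hW : Function.Periodic W 1) (ζ : ℝ) :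
    unsample N (fun t => latticeGenerator N c J t (W t)) ζ =
      advanceDelayOp c (1 / N) J (unsample N W) ζ := by
  have hright := unsample_shift hW 1 ζ
  have hleft := unsample_shift hW (-1) ζ
  push_cast [neg_div, ← sub_eq_add_neg] at hright hleft
  rw [advanceDelayOp, ← hright, ← hleft]
  simp only [unsample, latticeGenerator_apply, shift_apply, sub_add_cancel, ← sub_eq_add_neg,
    Finset.sum_add_distrib, Finset.sum_sub_distrib, ← Finset.smul_sum, Matrix.mulVec_sum]

theorem integral_comp_add_right_of_periodic {E : Type*} [NormedAddCommGroup E] [NormedSpace ℝ E]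
    {g : ℝ → E} (hg : Function.Periodic g 1) (a : ℝ) :
    ∫ ζ in (0 : ℝ)..1, g (ζ + a) = ∫ ζ in (0 : ℝ)..1, g ζ := by
  simpa [add_comm a] using (intervalIntegral.integral_comp_add_right (a := 0) (b := 1) g a).trans
    (by simpa [add_comm a] using hg.intervalIntegral_add_eq a 0)

theorem inner01_unsample {W : ℝ → ZMod N → Fin d → ℂ} (hWp : Function.Periodic W 1)
    (hWc : Continuous W) {h : ℝ → Fin d → ℂ} (hp : Function.Periodic h 1) (hc : Continuous h) :
    inner01 (unsample N W) h =
      ∫ ζ in (0 : ℝ)..1, ⟪latticeHilbert N d (W ζ), latticeHilbert N d (sample N h ζ)⟫_ℂ := by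
  let g : ZMod N → ℝ → ℂ := fun j ζ => star (W (ζ - j.val / N) j) ⬝ᵥ h ζ
  have hgc : ∀ j, Continuous (g j) := fun j =>
    (((continuous_apply j).comp hWc).comp (continuous_id.sub continuous_const)).star.dotProduct hc
  have hgp : ∀ j, Function.Periodic (g j) 1 := fun j ζ => by
    simp only [g]
    rw [add_sub_right_comm, hWp, hp]
  calc inner01 (unsample N W) h = ∫ ζ in (0 : ℝ)..1, ∑ j, g j ζ := by
        simp only [inner01, g, unsample, ← sum_dotProduct, ← star_sum]
        rfl
    _ = ∑ j, ∫ ζ in (0 : ℝ)..1, g j ζ :=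
        intervalIntegral.integral_finsetSum fun j _ => (hgc j).intervalIntegrable _ _
    _ = ∑ j : ZMod N, ∫ ζ in (0 : ℝ)..1, g j (ζ + j.val / N) :=
        Finset.sum_congr rfl fun j _ => (integral_comp_add_right_of_periodic (hgp j) _).symm
    _ = ∫ ζ in (0 : ℝ)..1, ∑ j : ZMod N, g j (ζ + j.val / N) :=
        (intervalIntegral.integral_finsetSum fun j _ =>
          ((hgc j).comp (continuous_add_const _)).intervalIntegrable _ _).symm
    _ = _ := by
        simp only [g, add_sub_cancel_right, inner_latticeHilbert, sample]

end Sampling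

section AdjointKernel

variable {d : ℕ}

theorem continuous_advanceDelayOp (c : ℂ) (k : ℝ) {J : ℝ → Matrix (Fin d) (Fin d) ℂ}
    {h : ℝ → Fin d → ℂ} (hJ : Continuous J) (hh : Continuous h) :
    Continuous (advanceDelayOp c k J h) :=
  ((((hh.comp (continuous_add_const k)).sub (hh.const_smul (2 : ℂ))).add
    (hh.comp (continuous_sub_right k))).const_smul c).add (hJ.matrix_mulVec hh)

theorem periodic_advanceDelayOp (c : ℂ) (k : ℝ) {J : ℝ → Matrix (Fin d) (Fin d) ℂ}
    {h : ℝ → Fin d → ℂ} (hJ : Function.Periodic J 1) (hh : Function.Periodic h 1) :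
    Function.Periodic (advanceDelayOp c k J h) 1 := by
  intro ζ
  simp only [advanceDelayOp, add_right_comm ζ 1 k, add_sub_right_comm ζ 1 k, hh _, hJ ζ]

/-- The operator `w ↦ -(μ [w(· + k) - 2 w + w(· - k)] + Df(u)ᵀ w) / ω`, so that the adjoint profile
equation reads `w' = adjointProfileOp μ f u k ω w`. -/
def adjointProfileOp (μ : ℝ) (f : (Fin d → ℝ) → Fin d → ℝ) (u : ℝ → Fin d → ℝ) (k ω : ℝ) :
    (ℝ → Fin d → ℂ) → ℝ → Fin d → ℂ :=
  advanceDelayOp (-conj ((μ / ω : ℝ) : ℂ)) k fun ζ => -(phaseJac f u ω ζ)ᴴ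

theorem adjointProfile_eq_zero_iff {ω : ℝ} (hω : ω ≠ 0) (μ k : ℝ) (f : (Fin d → ℝ) → Fin d → ℝ)
    (u : ℝ → Fin d → ℝ) (w : ℝ → Fin d → ℂ) (ζ : ℝ) (v : Fin d → ℂ) :
    (ω : ℂ) • v + (μ : ℂ) • (w (ζ - k) - (2 : ℂ) • w ζ + w (ζ + k)) +
      (jac f (u ζ)).transpose.mulVec (w ζ) = 0 ↔ v = adjointProfileOp μ f u k ω w ζ := by
  have hωC : (ω : ℂ) ≠ 0 := Complex.ofReal_ne_zero.2 hω
  have hop : (ω : ℂ) • adjointProfileOp μ f u k ω w ζ =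
      -((μ : ℂ) • (w (ζ - k) - (2 : ℂ) • w ζ + w (ζ + k)) + (jac f (u ζ))ᵀ *ᵥ w ζ) := by
    simp only [adjointProfileOp, advanceDelayOp, conjTranspose_phaseJac, Complex.conj_ofReal,
      Matrix.neg_mulVec, Matrix.smul_mulVec]
    push_cast
    match_scalars <;> field_simp
  rw [add_assoc, ← eq_neg_iff_add_eq_zero, ← hop]
  exact (smul_right_injective _ hωC).eq_iff

namespace IsH1Per

variable {w g : ℝ → Fin d → ℂ}

theorem eq_add_integral (h : IsH1Per w g) (x : ℝ) : w x = w 0 + ∫ y in (0 : ℝ)..x, g y := by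
  rw [h.integral_eq, add_sub_cancel]

theorem continuous (h : IsH1Per w g) : Continuous w := by
  have hint : ∀ a b : ℝ, IntervalIntegrable g volume a b := by
    refine h.periodic_deriv.intervalIntegrable one_ne_zero (t := 0) ?_
    rw [zero_add, intervalIntegrable_iff_integrableOn_Ioc_of_le zero_le_one]
    exact h.memLp.integrable one_le_two
  rw [funext h.eq_add_integral]
  exact continuous_const.add (intervalIntegral.continuous_primitive hint 0)

theorem hasDerivAt_of_ae_eq {G : ℝ → Fin d → ℂ} (h : IsH1Per w g) (hG : Continuous G)
    (hgG : g =ᵐ[volume] G) (ζ : ℝ) : HasDerivAt w (G ζ) ζ := by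
  have hw : w = fun x => w 0 + ∫ y in (0 : ℝ)..x, G y := by
    funext x
    rw [h.eq_add_integral x]
    congr 1
    exact intervalIntegral.integral_congr_ae (hgG.mono fun y hy _ => hy)
  rw [hw]
  exact (intervalIntegral.integral_hasDerivAt_right (hG.intervalIntegrable 0 ζ)
    (hG.stronglyMeasurableAtFilter volume (𝓝 ζ)) hG.continuousAt).const_add (w 0)

theorem of_hasDerivAt (hwp : Function.Periodic w 1) (hgp : Function.Periodic g 1)
    (hg : Continuous g) (hw : ∀ ζ, HasDerivAt w (g ζ) ζ) : IsH1Per w g where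
  periodic := hwp
  periodic_deriv := hgp
  memLp := by
    obtain ⟨C, hC⟩ := (isCompact_Icc (a := (0 : ℝ)) (b := 1)).exists_bound_of_continuousOn
      hg.continuousOn
    exact MemLp.of_bound hg.aestronglyMeasurable C
      (ae_restrict_of_forall_mem measurableSet_Ioc fun ζ hζ => hC ζ (Ioc_subset_Icc_self hζ))
  integral_eq := fun a b =>
    intervalIntegral.integral_eq_sub_of_hasDerivAt (fun ζ _ => hw ζ) (hg.intervalIntegrable a b)

end IsH1Per

theorem inKerAdjoint_iff {μ k ω : ℝ} {f : (Fin d → ℝ) → Fin d → ℝ} {u : ℝ → Fin d → ℝ}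
    {w : ℝ → Fin d → ℂ} (hω : ω ≠ 0) (hf : ContDiff ℝ 1 f) (hu : Continuous u)
    (hup : Function.Periodic u 1) :
    InKerAdjoint μ f u k ω w ↔ Function.Periodic w 1 ∧
      ∀ ζ, HasDerivAt w (adjointProfileOp μ f u k ω w ζ) ζ := by
  have hJ : Continuous fun ζ => -(phaseJac f u ω ζ)ᴴ :=
    (continuous_phaseJac hf hu ω).matrix_conjTranspose.neg
  have hJp : Function.Periodic (fun ζ => -(phaseJac f u ω ζ)ᴴ) 1 := fun ζ => by
    simp only [periodic_phaseJac f hup ω ζ]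
  constructor
  · rintro ⟨g, hg, heq⟩
    exact ⟨hg.periodic, hg.hasDerivAt_of_ae_eq (continuous_advanceDelayOp _ k hJ hg.continuous)
      (heq.mono fun ζ => (adjointProfile_eq_zero_iff hω μ k f u w ζ _).1)⟩
  · rintro ⟨hwp, hw⟩
    have hwc : Continuous w := continuous_iff_continuousAt.2 fun ζ => (hw ζ).continuousAt
    exact ⟨_, IsH1Per.of_hasDerivAt hwp (periodic_advanceDelayOp _ k hJp hwp)
      (continuous_advanceDelayOp _ k hJ hwc) hw,
      Eventually.of_forall fun ζ => (adjointProfile_eq_zero_iff hω μ k f u w ζ _).2 rfl⟩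

end AdjointKernel

section TwoParameterFamily

variable {E : Type*} [NormedAddCommGroup E] [NormedSpace ℝ E] {U : ℝ → ℝ → E} {k ζ : ℝ}
  {U' : ℝ × ℝ →L[ℝ] E}

theorem hasDerivAt_fst_of_hasFDerivAt
    (hU : HasFDerivAt (fun p : ℝ × ℝ => U p.1 p.2) U' (k, ζ)) :
    HasDerivAt (fun κ => U κ ζ) (U' (1, 0)) k :=
  hU.comp_hasDerivAt (f := fun κ => (κ, ζ)) k
    ((hasDerivAt_id k).prodMk (hasDerivAt_const k ζ))

theorem hasDerivAt_snd_of_hasFDerivAt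
    (hU : HasFDerivAt (fun p : ℝ × ℝ => U p.1 p.2) U' (k, ζ)) :
    HasDerivAt (U k) (U' (0, 1)) ζ :=
  hU.comp_hasDerivAt (f := fun η => (k, η)) ζ ((hasDerivAt_const ζ k).prodMk (hasDerivAt_id ζ))

theorem hasDerivAt_comp_add_mul {c : ℝ}
    (hU : DifferentiableAt ℝ (fun p : ℝ × ℝ => U p.1 p.2) (k, ζ + c * k)) :
    HasDerivAt (fun κ => U κ (ζ + c * κ))
      (deriv (fun κ => U κ (ζ + c * k)) k + c • deriv (U k) (ζ + c * k)) k := by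
  have hline : HasDerivAt (fun κ : ℝ => (κ, ζ + c * κ)) ((1, 0) + c • ((0, 1) : ℝ × ℝ)) k := by
    simpa using (hasDerivAt_id k).prodMk (((hasDerivAt_id k).const_mul c).const_add ζ)
  have hcomp := hU.hasFDerivAt.comp_hasDerivAt (f := fun κ => (κ, ζ + c * κ)) k hline
  rwa [map_add, map_smul, ← (hasDerivAt_fst_of_hasFDerivAt hU.hasFDerivAt).deriv,
    ← (hasDerivAt_snd_of_hasFDerivAt hU.hasFDerivAt).deriv] at hcomp

theorem exists_mixed_derivative (hU : ContDiffAt ℝ 2 (fun p : ℝ × ℝ => U p.1 p.2) (k, ζ)) :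
    ∃ m, HasDerivAt (fun η => deriv (fun κ => U κ η) k) m ζ ∧
      HasDerivAt (fun κ => deriv (U κ) ζ) m k := by
  set D := fderiv ℝ fun p : ℝ × ℝ => U p.1 p.2
  have hD : HasFDerivAt D (fderiv ℝ D (k, ζ)) (k, ζ) :=
    ((hU.fderiv_right (m := 1) (by norm_num)).differentiableAt (by simp)).hasFDerivAt
  have hDv : ∀ v : ℝ × ℝ, HasFDerivAt (fun p : ℝ × ℝ => D (p.1, p.2) v)
      (ContinuousLinearMap.apply ℝ E v ∘L fderiv ℝ D (k, ζ)) (k, ζ) := fun v =>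
    (ContinuousLinearMap.apply ℝ E v).hasFDerivAt.comp (k, ζ) hD
  have hdiff : ∀ᶠ p in 𝓝 (k, ζ), HasFDerivAt (fun p : ℝ × ℝ => U p.1 p.2) (D p) p :=
    (hU.eventually (by simp)).mono fun p hp => (hp.differentiableAt (by simp)).hasFDerivAt
  have hsymm : fderiv ℝ D (k, ζ) (0, 1) (1, 0) = fderiv ℝ D (k, ζ) (1, 0) (0, 1) :=
    (hU.isSymmSndFDerivAt (by simp)).eq _ _
  refine ⟨fderiv ℝ D (k, ζ) (0, 1) (1, 0), ?_, hsymm ▸ ?_⟩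
  · refine (hasDerivAt_snd_of_hasFDerivAt (U := fun κ η => D (κ, η) (1, 0))
      (hDv (1, 0))).congr_of_eventuallyEq ?_
    filter_upwards [(Continuous.prodMk_right k).tendsto ζ |>.eventually hdiff] with η hη
    exact (hasDerivAt_fst_of_hasFDerivAt hη).deriv
  · refine (hasDerivAt_fst_of_hasFDerivAt (U := fun κ η => D (κ, η) (0, 1))
      (hDv (0, 1))).congr_of_eventuallyEq ?_
    filter_upwards [(Continuous.prodMk_left ζ).tendsto k |>.eventually hdiff] with κ hκ
    exact (hasDerivAt_snd_of_hasFDerivAt hκ).deriv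

end TwoParameterFamily

section ProfileEquation

variable {d : ℕ}

/-- The complexification `toC` as a continuous real-linear map. -/
def toCL (d : ℕ) : (Fin d → ℝ) →L[ℝ] (Fin d → ℂ) :=
  ContinuousLinearMap.pi fun a => Complex.ofRealCLM ∘L ContinuousLinearMap.proj a

theorem toC_add (v w : Fin d → ℝ) : toC (v + w) = toC v + toC w := (toCL d).map_add v w

theorem toC_sub (v w : Fin d → ℝ) : toC (v - w) = toC v - toC w := (toCL d).map_sub v w

theorem toC_smul (c : ℝ) (v : Fin d → ℝ) : toC (c • v) = (c : ℂ) • toC v := by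
  funext a
  simp [toC]

theorem hasDerivAt_toC {h : ℝ → Fin d → ℝ} {h' : Fin d → ℝ} {t : ℝ} (hh : HasDerivAt h h' t) :
    HasDerivAt (fun t => toC (h t)) (toC h') t :=
  (toCL d).hasFDerivAt.comp_hasDerivAt t hh

theorem jac_mulVec_toC (f : (Fin d → ℝ) → Fin d → ℝ) (x v : Fin d → ℝ) :
    jac f x *ᵥ toC v = toC (fderiv ℝ f x v) := by
  have hv : v = ∑ b, v b • (Pi.single b 1 : Fin d → ℝ) := by
    simp [← Pi.single_smul, Finset.univ_sum_single]
  funext a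
  conv_rhs => rw [hv]
  simp only [Matrix.mulVec, dotProduct, jac, Matrix.of_apply, toC, map_sum, map_smul,
    Finset.sum_apply, Pi.smul_apply, smul_eq_mul, Complex.ofReal_sum, Complex.ofReal_mul, mul_comm]

/-- A `C²` family of periodic traveling waves, defined for wavenumbers near `k`. -/
structure IsWaveGerm (μ : ℝ) (f : (Fin d → ℝ) → Fin d → ℝ) (u : ℝ → ℝ → Fin d → ℝ) (ω : ℝ → ℝ)
    (k : ℝ) : Prop where
  contDiffAt : ∀ ζ, ContDiffAt ℝ 2 (fun p : ℝ × ℝ => u p.1 p.2) (k, ζ)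
  differentiableAt_freq : DifferentiableAt ℝ ω k
  eventually_periodic : ∀ᶠ κ in 𝓝 k, Function.Periodic (u κ) 1
  eventually_profile_eq : ∀ᶠ κ in 𝓝 k, ∀ ζ : ℝ,
    ω κ • deriv (u κ) ζ = μ • (u κ (ζ + κ) - (2 : ℝ) • u κ ζ + u κ (ζ - κ)) + f (u κ ζ)

variable {μ : ℝ} {f : (Fin d → ℝ) → Fin d → ℝ} {u : ℝ → ℝ → Fin d → ℝ} {ω : ℝ → ℝ} {k : ℝ}

theorem IsWaveFamily.isWaveGerm {I : Set ℝ} (hfam : IsWaveFamily μ f I u ω) (hI : I ∈ 𝓝 k) :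
    IsWaveGerm μ f u ω k where
  contDiffAt ζ := (hfam.smooth_profile.contDiffAt (prod_mem_nhds hI univ_mem)).of_le
    (WithTop.coe_le_coe.2 (le_top : (2 : ℕ∞) ≤ ⊤))
  differentiableAt_freq := (hfam.smooth_freq.contDiffAt hI).differentiableAt (by simp)
  eventually_periodic := mem_of_superset hI hfam.periodic
  eventually_profile_eq := mem_of_superset hI hfam.profile_eq

namespace IsWaveGerm

theorem differentiableAt (hfam : IsWaveGerm μ f u ω k) (ζ : ℝ) :
    DifferentiableAt ℝ (fun p : ℝ × ℝ => u p.1 p.2) (k, ζ) :=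
  (hfam.contDiffAt ζ).differentiableAt two_ne_zero

theorem hasDerivAt_profile (hfam : IsWaveGerm μ f u ω k) (ζ : ℝ) :
    HasDerivAt (u k) (deriv (u k) ζ) ζ :=
  (hasDerivAt_snd_of_hasFDerivAt (hfam.differentiableAt ζ).hasFDerivAt).differentiableAt.hasDerivAt

theorem continuous_profile (hfam : IsWaveGerm μ f u ω k) : Continuous (u k) :=
  continuous_iff_continuousAt.2 fun ζ => (hfam.hasDerivAt_profile ζ).continuousAt

theorem periodic_profile (hfam : IsWaveGerm μ f u ω k) : Function.Periodic (u k) 1 :=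
  hfam.eventually_periodic.self_of_nhds

theorem periodic_dζ (hfam : IsWaveGerm μ f u ω k) : Function.Periodic (dζ u k) 1 := by
  intro ζ
  have hderiv := congrFun (congrArg deriv (funext hfam.periodic_profile)) ζ
  rw [deriv_comp_add_const] at hderiv
  exact congrArg toC hderiv

theorem periodic_dk (hfam : IsWaveGerm μ f u ω k) : Function.Periodic (dk u k) 1 := fun ζ =>
  congrArg toC (EventuallyEq.deriv_eq (hfam.eventually_periodic.mono fun _ hκ => hκ ζ))

theorem hasDerivAt_dζ (hfam : IsWaveGerm μ f u ω k) (hf : Differentiable ℝ f) (hω : ω k ≠ 0)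
    (ζ : ℝ) :
    HasDerivAt (dζ u k)
      (advanceDelayOp ((μ / ω k : ℝ) : ℂ) k (phaseJac f (u k) (ω k)) (dζ u k) ζ) ζ := by
  have hu := hfam.hasDerivAt_profile
  have hprofile : deriv (u k) = fun ζ => (ω k)⁻¹ •
      (μ • (u k (ζ + k) - (2 : ℝ) • u k ζ + u k (ζ - k)) + f (u k ζ)) := by
    funext ζ
    rw [← hfam.eventually_profile_eq.self_of_nhds ζ, inv_smul_smul₀ hω]
  have hfu : HasDerivAt (fun ζ => f (u k ζ)) (fderiv ℝ f (u k ζ) (deriv (u k) ζ)) ζ :=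
    (hf (u k ζ)).hasFDerivAt.comp_hasDerivAt ζ (hu ζ)
  have hu' : HasDerivAt (deriv (u k)) ((ω k)⁻¹ • (μ • (deriv (u k) (ζ + k) -
      (2 : ℝ) • deriv (u k) ζ + deriv (u k) (ζ - k)) + fderiv ℝ f (u k ζ) (deriv (u k) ζ))) ζ := by
    conv => arg 1; rw [hprofile]
    exact ((((((hu (ζ + k)).comp_add_const ζ k).sub ((hu ζ).const_smul (2 : ℝ))).add
      ((hu (ζ - k)).comp_sub_const ζ k)).const_smul μ).add hfu).const_smul (ω k)⁻¹
  refine (hasDerivAt_toC hu').congr_deriv ?_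
  simp only [advanceDelayOp, phaseJac, Matrix.smul_mulVec, dζ, jac_mulVec_toC, toC_smul, toC_add,
    toC_sub]
  push_cast
  module

theorem hasDerivAt_dk (hfam : IsWaveGerm μ f u ω k) (hf : Differentiable ℝ f) (hω : ω k ≠ 0)
    (ζ : ℝ) :
    HasDerivAt (dk u k)
      (advanceDelayOp ((μ / ω k : ℝ) : ℂ) k (phaseJac f (u k) (ω k)) (dk u k) ζ +
        (((μ / ω k : ℝ) : ℂ) • (dζ u k (ζ + k) - dζ u k (ζ - k)) -
          ((deriv ω k / ω k : ℝ) : ℂ) • dζ u k ζ)) ζ := by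
  obtain ⟨m, hm, hm'⟩ := exists_mixed_derivative (hfam.contDiffAt ζ)
  have hplus := hasDerivAt_comp_add_mul (c := 1) (hfam.differentiableAt (ζ + 1 * k))
  have hminus := hasDerivAt_comp_add_mul (c := -1) (hfam.differentiableAt (ζ + -1 * k))
  have hzero := hasDerivAt_comp_add_mul (c := 0) (hfam.differentiableAt (ζ + 0 * k))
  simp only [one_mul, neg_mul, ← sub_eq_add_neg, zero_mul, add_zero, zero_smul, one_smul, neg_smul]
    at hplus hminus hzero
  have hfu : HasDerivAt (fun κ => f (u κ ζ)) (fderiv ℝ f (u k ζ) (deriv (fun κ => u κ ζ) k)) k :=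
    (hf (u k ζ)).hasFDerivAt.comp_hasDerivAt k hzero
  have hlhs := hfam.differentiableAt_freq.hasDerivAt.smul hm'
  have hrhs := (((hplus.sub (hzero.const_smul (2 : ℝ))).add hminus).const_smul μ).add hfu
  have hdiff := hlhs.unique (hrhs.congr_of_eventuallyEq
    (hfam.eventually_profile_eq.mono fun _ hκ => hκ ζ))
  have hm_eq := inv_smul_smul₀ hω m
  rw [eq_sub_of_add_eq hdiff] at hm_eq
  refine (hasDerivAt_toC hm).congr_deriv ?_
  rw [← hm_eq]
  simp only [advanceDelayOp, phaseJac, Matrix.smul_mulVec, dζ, dk, jac_mulVec_toC, toC_smul,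
    toC_add, toC_sub]
  push_cast
  module

end IsWaveGerm

end ProfileEquation

section InnerProduct

variable {d : ℕ} {w v v' : ℝ → Fin d → ℂ}

theorem inner01_add_right (hw : Continuous w) (hv : Continuous v) (hv' : Continuous v') :
    inner01 w (v + v') = inner01 w v + inner01 w v' := by
  have hint : ∀ {v : ℝ → Fin d → ℂ}, Continuous v →
      IntervalIntegrable (fun ζ => ∑ a, conj (w ζ a) * v ζ a) volume 0 1 := fun hv =>
    (Continuous.dotProduct hw.star hv).intervalIntegrable 0 1
  simp only [inner01, Pi.add_apply, mul_add, Finset.sum_add_distrib]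
  exact intervalIntegral.integral_add (hint hv) (hint hv')

theorem inner01_smul_right (a : ℂ) (w v : ℝ → Fin d → ℂ) :
    inner01 w (a • v) = a * inner01 w v := by
  simp only [inner01, Pi.smul_apply, smul_eq_mul, mul_left_comm _ a, ← Finset.mul_sum]
  exact intervalIntegral.integral_const_mul _ _

theorem inner01_smul_left (a : ℂ) (w v : ℝ → Fin d → ℂ) :
    inner01 (a • w) v = conj a * inner01 w v := by
  simp only [inner01, Pi.smul_apply, smul_eq_mul, map_mul, mul_assoc, ← Finset.mul_sum]
  exact intervalIntegral.integral_const_mul _ _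

end InnerProduct

section LatticeSolutions

variable {d N : ℕ} [NeZero N] {c : ℂ} {J : ℝ → Matrix (Fin d) (Fin d) ℂ} {v w y : ℝ → Fin d → ℂ}
  {W : ℝ → ZMod N → Fin d → ℂ}

theorem hasDerivAt_sample_solution (hvp : Function.Periodic v 1)
    (hv : ∀ ζ, HasDerivAt v (advanceDelayOp c (1 / N) J v ζ) ζ) (t : ℝ) :
    HasDerivAt (sample N v) (latticeGenerator N c J t (sample N v t)) t := by
  rw [latticeGenerator_sample c J hvp]
  exact hasDerivAt_sample N hv t

theorem hasDerivAt_unsample_solution (hWp : Function.Periodic W 1)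
    (hW : ∀ t, HasDerivAt W (latticeGenerator N c J t (W t)) t) (ζ : ℝ) :
    HasDerivAt (unsample N W) (advanceDelayOp c (1 / N) J (unsample N W) ζ) ζ := by
  rw [← unsample_latticeGenerator c J hWp]
  exact hasDerivAt_unsample N hW ζ

theorem inner01_unsample_solution (hJ : Continuous J) (hvp : Function.Periodic v 1)
    (hv : ∀ ζ, HasDerivAt v (advanceDelayOp c (1 / N) J v ζ) ζ) (hWp : Function.Periodic W 1)
    (hW : ∀ t, HasDerivAt W (latticeGenerator N (-conj c) (fun ζ => -(J ζ)ᴴ) t (W t)) t) :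
    inner01 (unsample N W) v =
      ⟪latticeHilbert N d (W 0), latticeHilbert N d (sample N v 0)⟫_ℂ := by
  have hA := continuous_latticeGenerator N c hJ
  have hvc : Continuous v := continuous_iff_continuousAt.2 fun ζ => (hv ζ).continuousAt
  have hWc : Continuous W := continuous_iff_continuousAt.2 fun t => (hW t).continuousAt
  have hconst : ∀ t, ⟪latticeHilbert N d (W t), latticeHilbert N d (sample N v t)⟫_ℂ =
      ⟪latticeHilbert N d (W 0), latticeHilbert N d (sample N v 0)⟫_ℂ := fun t => by
    rw [eq_evolution_apply hA (hasDerivAt_sample_solution hvp hv) t,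
      (isAdjointGenerator_latticeGenerator N c J).inner_evolution_apply hA hW]
  simp only [inner01_unsample hWp hWc hvp hvc, hconst, intervalIntegral.integral_const, sub_zero,
    one_smul]

theorem exists_normalized_adjoint_solution (hJ : Continuous J) (hJp : Function.Periodic J 1)
    {φ : ZMod N → Fin d → ℂ} (hφ : IsSimpleEigenvector (evolution (latticeGenerator N c J) 1 0 :
      (ZMod N → Fin d → ℂ) →ₗ[ℂ] _) 1 φ) :
    ∃ W : ℝ → ZMod N → Fin d → ℂ,
      (∀ t, HasDerivAt W (latticeGenerator N (-conj c) (fun ζ => -(J ζ)ᴴ) t (W t)) t) ∧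
      Function.Periodic W 1 ∧ ⟪latticeHilbert N d (W 0), latticeHilbert N d φ⟫_ℂ = 1 :=
  (isAdjointGenerator_latticeGenerator N c J).exists_normalized_periodic_solution
    (continuous_latticeGenerator N c hJ)
    (continuous_latticeGenerator N _ hJ.matrix_conjTranspose.neg)
    (periodic_latticeGenerator N _ fun ζ => by rw [hJp ζ]) hφ

theorem adjoint_solution_eq_zero (hJ : Continuous J)
    (hφ : IsSimpleEigenvector (evolution (latticeGenerator N c J) 1 0 :
      (ZMod N → Fin d → ℂ) →ₗ[ℂ] _) 1 (sample N v 0))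
    (hyp : Function.Periodic y 1)
    (hy : ∀ ζ, HasDerivAt y (advanceDelayOp (-conj c) (1 / N) (fun ζ => -(J ζ)ᴴ) y ζ) ζ)
    (h0 : ⟪latticeHilbert N d (sample N y 0), latticeHilbert N d (sample N v 0)⟫_ℂ = 0) :
    y = 0 := by
  have hzero : sample N y = 0 :=
    (isAdjointGenerator_latticeGenerator N c J).eq_zero_of_inner_eq_zero
      (continuous_latticeGenerator N c hJ)
      (continuous_latticeGenerator N _ hJ.matrix_conjTranspose.neg) hφ
      (hasDerivAt_sample_solution hyp hy) (by simpa using periodic_sample N hyp 0) h0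
  funext ζ
  simpa [sample] using congrFun (congrFun hzero ζ) 0

theorem advanceDelayOp_sub_smul (c : ℂ) (k : ℝ) (J : ℝ → Matrix (Fin d) (Fin d) ℂ)
    (y w : ℝ → Fin d → ℂ) (a : ℂ) (ζ : ℝ) :
    advanceDelayOp c k J (y - a • w) ζ =
      advanceDelayOp c k J y ζ - a • advanceDelayOp c k J w ζ := by
  simp only [advanceDelayOp, Pi.sub_apply, Pi.smul_apply, Matrix.mulVec_sub, Matrix.mulVec_smul]
  module

theorem exists_eq_smul_of_adjoint_solutions (hJ : Continuous J)
    (hφ : IsSimpleEigenvector (evolution (latticeGenerator N c J) 1 0 :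
      (ZMod N → Fin d → ℂ) →ₗ[ℂ] _) 1 (sample N v 0))
    (hwp : Function.Periodic w 1)
    (hw : ∀ ζ, HasDerivAt w (advanceDelayOp (-conj c) (1 / N) (fun ζ => -(J ζ)ᴴ) w ζ) ζ)
    (hw0 : w ≠ 0) (hyp : Function.Periodic y 1)
    (hy : ∀ ζ, HasDerivAt y (advanceDelayOp (-conj c) (1 / N) (fun ζ => -(J ζ)ᴴ) y ζ) ζ) :
    ∃ a : ℂ, y = a • w := by
  let p : (ℝ → Fin d → ℂ) → ℂ := fun h =>
    ⟪latticeHilbert N d (sample N h 0), latticeHilbert N d (sample N v 0)⟫_ℂ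
  have hp : p w ≠ 0 := fun h0 => hw0 (adjoint_solution_eq_zero hJ hφ hwp hw h0)
  refine ⟨conj (p y / p w), sub_eq_zero.1 (adjoint_solution_eq_zero hJ hφ ?_ (fun ζ => ?_) ?_)⟩
  · intro ζ
    simp only [Pi.sub_apply, Pi.smul_apply, hyp ζ, hwp ζ]
  · rw [advanceDelayOp_sub_smul]
    exact (hy ζ).sub ((hw ζ).const_smul _)
  · have hsample : sample N (y - conj (p y / p w) • w) 0 =
        sample N y 0 - conj (p y / p w) • sample N w 0 := rfl
    rw [hsample, map_sub, map_smul, inner_sub_left, inner_smul_left, Complex.conj_conj]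
    exact sub_eq_zero.2 (div_mul_cancel₀ (p y) hp).symm

theorem exists_periodic_lattice_solution (hJ : Continuous J) (hJp : Function.Periodic J 1)
    {φ : ZMod N → Fin d → ℂ} (hφ : IsSimpleEigenvector (evolution (latticeGenerator N c J) 1 0 :
      (ZMod N → Fin d → ℂ) →ₗ[ℂ] _) 1 φ)
    {F : ℝ → Fin d → ℂ} (hFp : Function.Periodic F 1) (hF : Continuous F)
    (horth : ∀ y : ℝ → Fin d → ℂ, Function.Periodic y 1 →
      (∀ ζ, HasDerivAt y (advanceDelayOp (-conj c) (1 / N) (fun ζ => -(J ζ)ᴴ) y ζ) ζ) →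
      inner01 y F = 0) :
    ∃ Z : ℝ → ZMod N → Fin d → ℂ, Z 1 = Z 0 ∧
      ∀ t, HasDerivAt Z (latticeGenerator N c J t (Z t) + sample N F t) t := by
  obtain ⟨W, hW, hWp, hWφ⟩ := exists_normalized_adjoint_solution hJ hJp hφ
  have hWc : Continuous W := continuous_iff_continuousAt.2 fun t => (hW t).continuousAt
  refine (isAdjointGenerator_latticeGenerator N c J).exists_periodic_solution
    (continuous_latticeGenerator N c hJ) hφ hW (by simpa using hWp 0) (by simp [hWφ])
    (continuous_sample N hF) ?_
  rw [← inner01_unsample hWp hWc hFp hF]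
  exact horth _ (periodic_unsample N hWp) (hasDerivAt_unsample_solution hWp hW)

/-- The forcing of the second corrector in the expansion of the Bloch eigenvector
`v + x w + x² z + ⋯` with Floquet multiplier `exp (ν₁ x + ν₂ x² + ⋯)`. -/
def secondOrderForcing (c : ℂ) (k : ℝ) (v w : ℝ → Fin d → ℂ) (ν₁ ν₂ : ℂ) (ζ : ℝ) : Fin d → ℂ :=
  c • (w (ζ + k) - w (ζ - k)) + (c / 2) • (v (ζ + k) + v (ζ - k)) - ν₂ • v ζ - ν₁ • w ζ

theorem continuous_secondOrderForcing (c : ℂ) (k : ℝ) (hv : Continuous v) (hw : Continuous w)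
    (ν₁ ν₂ : ℂ) : Continuous (secondOrderForcing c k v w ν₁ ν₂) := by
  unfold secondOrderForcing
  fun_prop

theorem periodic_secondOrderForcing (c : ℂ) (k : ℝ) (hv : Function.Periodic v 1)
    (hw : Function.Periodic w 1) (ν₁ ν₂ : ℂ) :
    Function.Periodic (secondOrderForcing c k v w ν₁ ν₂) 1 := fun ζ => by
  simp only [secondOrderForcing, add_right_comm ζ 1 k, add_sub_right_comm ζ 1 k, hv _, hw _]

theorem sample_secondOrderForcing (c : ℂ) (hv : Function.Periodic v 1)
    (hw : Function.Periodic w 1) (ν₁ ν₂ : ℂ) (t : ℝ) :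
    sample N (secondOrderForcing c (1 / N) v w ν₁ ν₂) t =
      (c • (shift N 1 - shift N (-1)) : (ZMod N → Fin d → ℂ) →L[ℂ] _) (sample N w t) +
        ((c / 2) • (shift N 1 + shift N (-1)) : (ZMod N → Fin d → ℂ) →L[ℂ] _) (sample N v t) -
          ν₂ • sample N v t - ν₁ • sample N w t := by
  simp only [add_apply, sub_apply, smul_apply, shift_one_sample hv, shift_neg_one_sample hv,
    shift_one_sample hw, shift_neg_one_sample hw]
  rfl

theorem exists_approximate_bloch_eigenvector (hJ : Continuous J) (hJp : Function.Periodic J 1)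
    {ν₁ ν₂ : ℂ}
    (hvp : Function.Periodic v 1) (hv : ∀ ζ, HasDerivAt v (advanceDelayOp c (1 / N) J v ζ) ζ)
    (hφ : IsSimpleEigenvector (evolution (latticeGenerator N c J) 1 0 :
      (ZMod N → Fin d → ℂ) →ₗ[ℂ] _) 1 (sample N v 0))
    (hwp : Function.Periodic w 1)
    (hw : ∀ ζ, HasDerivAt w (advanceDelayOp c (1 / N) J w ζ +
      (c • (v (ζ + 1 / N) - v (ζ - 1 / N)) - ν₁ • v ζ)) ζ)
    (horth : ∀ y : ℝ → Fin d → ℂ, Function.Periodic y 1 →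
      (∀ ζ, HasDerivAt y (advanceDelayOp (-conj c) (1 / N) (fun ζ => -(J ζ)ᴴ) y ζ) ζ) →
      inner01 y (secondOrderForcing c (1 / N) v w ν₁ ν₂) = 0) :
    ∃ P : ℂ → ZMod N → Fin d → ℂ, Tendsto P (𝓝 0) (𝓝 (sample N v 0)) ∧
      (fun x => complexFloquet N c J x (P x) - Complex.exp (ν₁ * x + ν₂ * x ^ 2) • P x)
        =O[𝓝 0] fun x => x ^ 3 := by
  have hvc : Continuous v := continuous_iff_continuousAt.2 fun ζ => (hv ζ).continuousAt
  have hwc : Continuous w := continuous_iff_continuousAt.2 fun ζ => (hw ζ).continuousAt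
  obtain ⟨Z, hZp, hZ⟩ := exists_periodic_lattice_solution hJ hJp hφ
    (periodic_secondOrderForcing c (1 / N) hvp hwp ν₁ ν₂)
    (continuous_secondOrderForcing c (1 / N) hvc hwc ν₁ ν₂) horth
  have hsample_w : ∀ t, HasDerivAt (sample N w) (latticeGenerator N c J t (sample N w t) +
      ((c • (shift N 1 - shift N (-1)) : (ZMod N → Fin d → ℂ) →L[ℂ] _) (sample N v t) -
        ν₁ • sample N v t)) t := fun t => by
    refine (hasDerivAt_sample N hw t).congr_deriv ?_
    simp only [latticeGenerator_sample c J hwp, sub_apply, smul_apply, shift_one_sample hvp,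
      shift_neg_one_sample hvp]
    rfl
  simp only [sample_secondOrderForcing c hvp hwp] at hZ
  refine ⟨fun x => sample N v 0 + x • sample N w 0 + x ^ 2 • Z 0, ?_,
    isBigO_evolution_formal_eigenpair (continuous_latticeGenerator N c hJ)
      (differentiable_blochPerturbation N c).continuous
      (isBigO_blochPerturbation_sub N c) (hasDerivAt_sample_solution hvp hv) hsample_w hZ
      (by simpa using periodic_sample N hvp 0) (by simpa using periodic_sample N hwp 0) hZp⟩
  refine Continuous.tendsto' (by fun_prop) _ _ ?_
  simp

end LatticeSolutions

section CriticalMultiplier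

variable {d N : ℕ} [NeZero N] {μ : ℝ} {f : (Fin d → ℝ) → Fin d → ℝ}

theorem Nondegenerate.isSimpleEigenvector {u : ℝ → ℝ → Fin d → ℝ} {ω₀ : ℝ}
    (hA : Nondegenerate N μ f (u (1 / N)) ω₀) (hω : ω₀ ≠ 0) (hf : ContDiff ℝ 1 f)
    (hu : Continuous (u (1 / N))) :
    IsSimpleEigenvector (complexFloquet N ((μ / ω₀ : ℝ) : ℂ) (phaseJac f (u (1 / N)) ω₀) 0 :
      (ZMod N → Fin d → ℂ) →ₗ[ℂ] _) 1 (sample N (dζ u (1 / N)) 0) := by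
  have hmode : translationMode N (u (1 / N)) = sample N (dζ u (1 / N)) 0 := by
    funext j
    simp only [translationMode, sample, dζ, zero_add, one_div_mul_eq_div]
  have hfloquet := floquet_eq_complexFloquet N hω hf hu μ 0
  rw [Complex.ofReal_zero, mul_zero] at hfloquet
  exact ⟨hmode ▸ hA.1, hmode ▸ hfloquet ▸ hA.2⟩

theorem inner01_secondOrderForcing {u : ℝ → ℝ → Fin d → ℝ} {w : ℝ → Fin d → ℂ} {k : ℝ}
    (hw : Continuous w) (hv : Continuous (dζ u k)) (hk : Continuous (dk u k)) (μ ω₀ : ℝ)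
    (ν₁ ν₂ : ℂ) :
    inner01 w (secondOrderForcing ((μ / ω₀ : ℝ) : ℂ) k (dζ u k) (dk u k) ν₁ ν₂) =
      (ω₀ : ℂ)⁻¹ * diffusionCoeff μ u k w - ν₂ * inner01 w (dζ u k) - ν₁ * inner01 w (dk u k) := by
  let g : ℝ → Fin d → ℂ := fun ζ => (μ : ℂ) • (dk u k (ζ + k) - dk u k (ζ - k)) +
    ((1 / 2 : ℂ) * μ) • (dζ u k (ζ + k) + dζ u k (ζ - k))
  have hg : Continuous g := by fun_prop
  have hsplit : secondOrderForcing ((μ / ω₀ : ℝ) : ℂ) k (dζ u k) (dk u k) ν₁ ν₂ =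
      (ω₀ : ℂ)⁻¹ • g + ((-ν₂) • dζ u k + (-ν₁) • dk u k) := by
    funext ζ
    simp only [secondOrderForcing, Pi.add_apply, Pi.smul_apply, g]
    push_cast
    module
  rw [hsplit, inner01_add_right hw (by fun_prop) (by fun_prop),
    inner01_add_right hw (by fun_prop) (by fun_prop), inner01_smul_right, inner01_smul_right,
    inner01_smul_right, diffusionCoeff]
  ring

namespace IsWaveGerm

variable {u : ℝ → ℝ → Fin d → ℝ} {ω : ℝ → ℝ}

theorem exists_isAdjointMode (hfam : IsWaveGerm μ f u ω (1 / N)) (hf : ContDiff ℝ 1 f)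
    (hω : ω (1 / N) ≠ 0) (hA : Nondegenerate N μ f (u (1 / N)) (ω (1 / N))) :
    ∃ w, IsAdjointMode μ f (u (1 / N)) (1 / N) (ω (1 / N)) w := by
  have hu := hfam.continuous_profile
  have hJ := continuous_phaseJac hf hu (ω (1 / N))
  have hφ := hA.isSimpleEigenvector hω hf hu
  rw [complexFloquet_zero] at hφ
  obtain ⟨W, hW, hWp, hWφ⟩ :=
    exists_normalized_adjoint_solution hJ (periodic_phaseJac f hfam.periodic_profile _) hφ
  have hw := hasDerivAt_unsample_solution hWp hW
  have hwp := periodic_unsample N hWp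
  have hnorm : inner01 (unsample N W) (dζ u (1 / N)) = 1 := by
    rw [inner01_unsample_solution hJ hfam.periodic_dζ
      (hfam.hasDerivAt_dζ (hf.differentiable one_ne_zero) hω) hWp hW, hWφ]
  have hw0 : unsample N W ≠ 0 := fun h0 => by simp [h0, inner01] at hnorm
  have hker := fun w => inKerAdjoint_iff (μ := μ) (k := 1 / N) (w := w) hω hf hu
    hfam.periodic_profile
  exact ⟨unsample N W, (hker _).2 ⟨hwp, hw⟩, fun y hy => exists_eq_smul_of_adjoint_solutions hJ hφ
    hwp hw hw0 ((hker y).1 hy).1 ((hker y).1 hy).2, hnorm⟩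

theorem isBigO_multiplier_sub (hfam : IsWaveGerm μ f u ω (1 / N)) (hf : ContDiff ℝ 1 f)
    (hω : ω (1 / N) ≠ 0) (hA : Nondegenerate N μ f (u (1 / N)) (ω (1 / N)))
    {w : ℝ → Fin d → ℂ} (hw : IsAdjointMode μ f (u (1 / N)) (1 / N) (ω (1 / N)) w)
    {lam : ℂ → ℂ} (hlam : Tendsto lam (𝓝 0) (𝓝 1))
    (hspec : ∀ᶠ x in 𝓝 0, lam x ∈ spectrum ℂ (complexFloquet N ((μ / ω (1 / N) : ℝ) : ℂ)
      (phaseJac f (u (1 / N)) (ω (1 / N))) x)) :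
    (fun x => lam x - Complex.exp (1 / ω (1 / N) * (x * deriv ω (1 / N) + x ^ 2 *
      (diffusionCoeff μ u (1 / N) w - deriv ω (1 / N) * inner01 w (dk u (1 / N))))))
      =O[𝓝 0] fun x => x ^ 3 := by
  have hu := hfam.continuous_profile
  have hup := hfam.periodic_profile
  have hJ := continuous_phaseJac hf hu (ω (1 / N))
  have hφ := hA.isSimpleEigenvector hω hf hu
  have hv := hfam.hasDerivAt_dζ (hf.differentiable one_ne_zero) hω
  have hk := hfam.hasDerivAt_dk (hf.differentiable one_ne_zero) hω
  have hvc : Continuous (dζ u (1 / N)) := continuous_iff_continuousAt.2 fun ζ => (hv ζ).continuousAt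
  have hkc : Continuous (dk u (1 / N)) := continuous_iff_continuousAt.2 fun ζ => (hk ζ).continuousAt
  have hwc : Continuous w := continuous_iff_continuousAt.2 fun ζ =>
    (((inKerAdjoint_iff hω hf hu hup).1 hw.1).2 ζ).continuousAt
  set D := diffusionCoeff μ u (1 / N) w with hD
  set q := inner01 w (dk u (1 / N)) with hq
  let ν₁ : ℂ := ((deriv ω (1 / N) / ω (1 / N) : ℝ) : ℂ)
  let ν₂ : ℂ := (ω (1 / N) : ℂ)⁻¹ * D - ν₁ * q
  have horth : inner01 w (secondOrderForcing ((μ / ω (1 / N) : ℝ) : ℂ) (1 / N) (dζ u (1 / N))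
      (dk u (1 / N)) ν₁ ν₂) = 0 := by
    have hnorm : inner01 w (dζ u (1 / N)) = 1 := hw.2.2
    rw [inner01_secondOrderForcing hwc hvc hkc, hnorm]
    simp only [ν₂, ← hD, ← hq]
    ring
  obtain ⟨P, hP, hres⟩ := exists_approximate_bloch_eigenvector hJ (periodic_phaseJac f hup _)
    hfam.periodic_dζ hv (by rwa [complexFloquet_zero] at hφ) hfam.periodic_dk hk fun y hyp hy => by
      obtain ⟨a, rfl⟩ := hw.2.1 y ((inKerAdjoint_iff hω hf hu hup).2 ⟨hyp, hy⟩)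
      rw [inner01_smul_left, horth, mul_zero]
  have hz : Tendsto (fun x : ℂ => Complex.exp (ν₁ * x + ν₂ * x ^ 2)) (𝓝 0) (𝓝 1) :=
    Continuous.tendsto' (by fun_prop) _ _ (by simp)
  refine (isBigO_eigenvalue_sub (differentiable_complexFloquet N _ hJ) hφ tendsto_id hlam hspec hz
    hP hres).congr_left fun x => ?_
  simp only [ν₁, ν₂]
  push_cast
  ring_nf

end IsWaveGerm

theorem exists_Icc_of_eventually_nhds_zero {p : ℂ → Prop} (hp : ∀ᶠ x in 𝓝 0, p x) {r : ℝ}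
    (hr : 0 < r) : ∃ ξ₀ ∈ Ioo 0 r, ∀ ξ ∈ Icc (-ξ₀) ξ₀, p (Complex.I * (ξ : ℝ)) := by
  obtain ⟨δ, hδ, hpδ⟩ := Metric.eventually_nhds_iff.1 hp
  obtain ⟨ξ₀, hξ₀, hlt⟩ := exists_between (lt_min hδ hr)
  refine ⟨ξ₀, ⟨hξ₀, hlt.trans_le (min_le_right δ r)⟩, fun ξ hξ => hpδ ?_⟩
  simpa using (abs_le.2 hξ).trans_lt (hlt.trans_le (min_le_left δ r))

end CriticalMultiplier

end LatticeRD

end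

theorem theorem4p1_general {d : ℕ} (N : ℕ) [NeZero N] (μ : ℝ)
    (f : (Fin d → ℝ) → Fin d → ℝ) (hf : ContDiff ℝ 1 f)
    (u : ℝ → ℝ → Fin d → ℝ) (ω : ℝ → ℝ)
    (hfam : LatticeRD.IsWaveGerm μ f u ω (1 / N))
    (hω : ω (1 / N) ≠ 0)
    (hA : LatticeRD.Nondegenerate N μ f (u (1 / N)) (ω (1 / N))) :
    ∃ uad : ℝ → Fin d → ℂ,
      LatticeRD.IsAdjointMode μ f (u (1 / N)) (1 / N) (ω (1 / N)) uad ∧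
      ∃ ε₀ : ℝ, 0 < ε₀ ∧ ∃ ξ₀ ∈ Set.Ioo (0 : ℝ) (Real.pi / N), ∃ lam : ℝ → ℂ,
        AnalyticOnNhd ℝ lam (Set.Icc (-ξ₀) ξ₀) ∧
        (∀ ξ ∈ Set.Icc (-ξ₀) ξ₀,
          spectrum ℂ (LatticeRD.floquet N μ f (u (1 / N)) (ω (1 / N)) ξ) ∩ Metric.ball 1 ε₀
            = {lam ξ}) ∧
        (∀ ξ ∈ Set.Icc (-ξ₀) ξ₀,
          Module.finrank ℂ (LatticeRD.genEigenspace N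
            (LatticeRD.floquet N μ f (u (1 / N)) (ω (1 / N)) ξ) (lam ξ)) = 1) ∧
        (fun ξ : ℝ => lam ξ - Complex.exp ((1 / ((ω (1 / N) : ℝ) : ℂ)) *
            (Complex.I * ξ * ((deriv ω (1 / N) : ℝ) : ℂ) + (Complex.I * ξ) ^ 2 *
              (LatticeRD.diffusionCoeff μ u (1 / N) uad - ((deriv ω (1 / N) : ℝ) : ℂ) *
                LatticeRD.inner01 uad (LatticeRD.dk u (1 / N))))))
          =O[𝓝 0] fun ξ : ℝ => |ξ| ^ 3 := by
  have hu := hfam.continuous_profile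
  have hφ := hA.isSimpleEigenvector hω hf hu
  obtain ⟨uad, hmode⟩ := hfam.exists_isAdjointMode hf hω hA
  obtain ⟨ε, hε, lam, hlam₀, hlam⟩ := LatticeRD.exists_eigenvalue_curve
    (LatticeRD.differentiable_complexFloquet N _ (LatticeRD.continuous_phaseJac hf hu _)) hφ
  obtain ⟨ξ₀, hξ₀, hcurve⟩ := LatticeRD.exists_Icc_of_eventually_nhds_zero hlam
    (div_pos Real.pi_pos (Nat.cast_pos.2 (NeZero.pos N)))
  have hO := hfam.isBigO_multiplier_sub hf hω hA hmode
    (hlam₀ ▸ hlam.self_of_nhds.1.continuousAt.tendsto)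
    (hlam.mono fun x hx => (hx.2.1.symm.subset rfl).1)
  have hfloquet := LatticeRD.floquet_eq_complexFloquet N hω hf hu
  refine ⟨uad, hmode, ε, hε, ξ₀, hξ₀, fun ξ => lam (Complex.I * ξ), fun ξ hξ => ?_,
    fun ξ hξ => by rw [hfloquet]; exact (hcurve ξ hξ).2.1,
    fun ξ hξ => by rw [hfloquet]; exact (hcurve ξ hξ).2.2, ?_⟩
  · exact AnalyticAt.comp (f := fun ξ : ℝ => Complex.I * (ξ : ℂ))
      (hcurve ξ hξ).1.restrictScalars
      (analyticAt_const.mul (Complex.ofRealCLM.analyticAt ξ))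
  · have hI : Tendsto (fun ξ : ℝ => Complex.I * (ξ : ℂ)) (𝓝 0) (𝓝 0) :=
      Continuous.tendsto' (by fun_prop) _ _ (by simp)
    exact (hO.comp_tendsto hI).trans (Asymptotics.isBigO_of_le _ fun ξ => by simp)

theorem theorem4p1 {d : ℕ} (N : ℕ) [NeZero N] (μ : ℝ)
    (f : (Fin d → ℝ) → Fin d → ℝ) (hf : ContDiff ℝ ((⊤ : ℕ∞) : WithTop ℕ∞) f)
    (I : Set ℝ) (hI : IsOpen I) (hk : (1 / N : ℝ) ∈ I)
    (u : ℝ → ℝ → Fin d → ℝ) (ω : ℝ → ℝ)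
    (hfam : LatticeRD.IsWaveFamily μ f I u ω)
    (hω : ω (1 / N) ≠ 0)
    (hA : LatticeRD.Nondegenerate N μ f (u (1 / N)) (ω (1 / N))) :
    ∃ uad : ℝ → Fin d → ℂ,
      LatticeRD.IsAdjointMode μ f (u (1 / N)) (1 / N) (ω (1 / N)) uad ∧
      ∃ ε₀ : ℝ, 0 < ε₀ ∧ ∃ ξ₀ ∈ Set.Ioo (0 : ℝ) (Real.pi / N), ∃ lam : ℝ → ℂ,
        AnalyticOnNhd ℝ lam (Set.Icc (-ξ₀) ξ₀) ∧
        (∀ ξ ∈ Set.Icc (-ξ₀) ξ₀,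
          spectrum ℂ (LatticeRD.floquet N μ f (u (1 / N)) (ω (1 / N)) ξ) ∩ Metric.ball 1 ε₀
            = {lam ξ}) ∧
        (∀ ξ ∈ Set.Icc (-ξ₀) ξ₀,
          Module.finrank ℂ (LatticeRD.genEigenspace N
            (LatticeRD.floquet N μ f (u (1 / N)) (ω (1 / N)) ξ) (lam ξ)) = 1) ∧
        (LatticeRD.inner01 uad (LatticeRD.dk u (1 / N)) = 0 →
          (fun ξ : ℝ => lam ξ - Complex.exp ((1 / ((ω (1 / N) : ℝ) : ℂ)) *
              (Complex.I * ξ * ((deriv ω (1 / N) : ℝ) : ℂ) +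
                (Complex.I * ξ) ^ 2 * LatticeRD.diffusionCoeff μ u (1 / N) uad)))
            =O[𝓝 0] fun ξ : ℝ => |ξ| ^ 3) := by
  obtain ⟨uad, hmode, ε₀, hε₀, ξ₀, hξ₀, lam, hlam, hspec, hsimple, hO⟩ :=
    theorem4p1_general N μ f (hf.of_le (by norm_cast)) u ω
      (hfam.isWaveGerm (hI.mem_nhds hk)) hω hA
  exact ⟨uad, hmode, ε₀, hε₀, ξ₀, hξ₀, lam, hlam, hspec, hsimple, fun h => by
    simpa only [h, mul_zero, sub_zero] using hO⟩
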